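/- Let $G$ be a countably infinite discrete amenable group acting continuously on an infinite compact metrizable space $X$, and suppose that the action is free and minimal (every orbit is dense). Let $M_G(X)$ be the set of $G$-invariant Borel probability measures on $X$ with the weak* topology, and let $E_G(X)$ be the set of its extreme points (the ergodic measures). Suppose that $E_G(X)$ is compact and zero-dimensional (of covering dimension zero) in the weak* topology. Then the following are equivalent: (i) the action is almost finite; (ii) the action is $m$-almost finite for some integer $m\ge 0$; (iii) the action has comparison; (iv) the action has $m$-comparison for some integer $m\ge 0$. Here, for an integer $m\ge 0$, a closed set $F\subseteq X$ and an open set $O\subseteq X$, write $F\prec_m O$ if there are a finite collection $\mathcal U$ of open sets covering $F$, elements $s_U\in G$ for $U\in\mathcal U$, and a partition $\mathcal U=\mathcal U_0\sqcup\dots\sqcup\mathcal U_m$ (some parts possibly empty) such that for each $i$ the sets $s_UU$, $U\in\mathcal U_i$, are pairwise disjoint subsets of $O$; write $\prec$ for $\prec_0$. The action has *$m$-comparison* if $F\prec_m O$ whenever $F$ is closed, $O$ is open and $\mu(F)<\mu(O)$ for all $\mu\in M_G(X)$; it has *comparison* if it has $0$-comparison. Fix a metric $d$ inducing the topology of $X$.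 A *tower* is a pair $(S,V)$ of a finite set $S\subseteq G$ and a set $V\subseteq X$ such that the sets $sV$, $s\in S$, are pairwise disjoint; $SV$ denotes their union. For a finite set $K\subseteq G$ and $\delta>0$, a nonempty finite set $S\subseteq G$ is *$(K,\delta)$-invariant* if $|\{s\in S: Ks\subseteq S\}|\ge(1-\delta)|S|$; amenability of $G$ means that such sets $S$ exist for all $K$ and $\delta$. The action is *$m$-almost finite* if for every integer $n\ge 1$, finite $K\subseteq G$ and $\delta>0$ there is a finite collection of towers $(S_i,\overline{V_i})$, $i\in I$, such that 1. each $V_i$ is open; 2. each $S_i$ is $(K,\delta)$-invariant; 3. $\operatorname{diam}(s\overline{V_i})<\delta$ for all $i\in I$ and $s\in S_i$, and $I$ can be partitioned into $m+1$ (possibly empty) parts such that $S_i\overline{V_i}\cap S_j\overline{V_j}=\emptyset$ for distinct $i,j$ in the same part; 4. there are $S_i'\subseteq S_i$ with $|S_i'|\le|S_i|/n$ for each $i\in I$ and $X\setminus\bigcup_{i\in I}S_iV_i\prec\bigcup_{i\in I}S_i'V_i$. It is *almost finite* if it is $0$-almost finite. -/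

import Mathlib

open MeasureTheory Set
open scoped Pointwise ENNReal

noncomputable section

/-- A nonempty finite subset `S` of a group is `(K, δ)`-invariant if at least a proportion `1 - δ`
of its elements `s` satisfy `K s ⊆ S`. -/
def IsInvariantShape {G : Type*} [Group G] (K : Finset G) (δ : ℝ) (S : Finset G) : Prop :=
  S.Nonempty ∧ (1 - δ) * (S.card : ℝ) ≤ (({s : G | s ∈ S ∧ ∀ k ∈ K, k * s ∈ S}).ncard : ℝ)

/-- Amenability of a discrete group, by the Følner condition. -/
def IsAmenableGroup (G : Type*) [Group G] : Prop :=
  ∀ (K : Finset G) (δ : ℝ), 0 < δ → ∃ S : Finset G, IsInvariantShape K δ S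

/-- The action is free: all stabilizers are trivial. -/
def IsFreeAction (G X : Type*) [Group G] [MulAction G X] : Prop :=
  ∀ (g : G) (x : X), g • x = x → g = 1

section Measures

variable (G X : Type*) [Group G] [TopologicalSpace X] [MeasurableSpace X] [BorelSpace X]
  [MulAction G X]

/-- `M_G(X)`: the `G`-invariant Borel probability measures on `X` (on a compact metric space, the
case of interest, all of them are regular). The ambient type `ProbabilityMeasure X` carries the
weak* topology. -/
def invariantMeasures : Set (ProbabilityMeasure X) :=
  {μ | SMulInvariantMeasure G X (μ : Measure X)}

/-- `E_G(X)`: the extreme points of the convex set `M_G(X)`. The convex combinations are taken in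
the `ℝ≥0∞`-module of all measures on `X`; since a probability measure that is a combination
`a • μ + b • ν` with `a + b = 1` has finite coefficients, these are the usual ones. -/
def ergodicMeasures : Set (ProbabilityMeasure X) :=
  {μ | (μ : Measure X) ∈
    extremePoints ℝ≥0∞ ((fun ν : ProbabilityMeasure X => (ν : Measure X)) '' invariantMeasures G X)}

end Measures

/-- A topological space has covering dimension zero (at most zero): every finite open cover is
refined by a finite cover consisting of pairwise disjoint open sets. -/
def IsZeroDimensional (Y : Type*) [TopologicalSpace Y] : Prop :=
  ∀ 𝒰 : Set (Set Y), 𝒰.Finite → (∀ U ∈ 𝒰, IsOpen U) → ⋃₀ 𝒰 = univ →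
    ∃ 𝒱 : Set (Set Y), 𝒱.Finite ∧ (∀ V ∈ 𝒱, IsOpen V) ∧ ⋃₀ 𝒱 = univ ∧
      (∀ V ∈ 𝒱, ∃ U ∈ 𝒰, V ⊆ U) ∧ 𝒱.PairwiseDisjoint id

section Comparison

variable (G : Type*) {X : Type*} [Group G] [TopologicalSpace X] [MulAction G X]

/-- The relation `F ≺ₘ O` (used for `F` closed and `O` open): finitely many open sets `U j` cover
`F` and can be coloured with `m + 1` colours and translated by group elements `s j` into `O`, so
that the translates of the sets of each single colour are pairwise disjoint. -/
def SubequivM (m : ℕ) (F O : Set X) : Prop :=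
  ∃ (N : ℕ) (U : Fin N → Set X) (s : Fin N → G) (c : Fin N → Fin (m + 1)),
    (∀ j, IsOpen (U j)) ∧ F ⊆ ⋃ j, U j ∧ (∀ j, s j • U j ⊆ O) ∧
      ∀ j k, j ≠ k → c j = c k → Disjoint (s j • U j) (s k • U k)

variable (X) in
/-- Dynamical `m`-comparison. -/
def HasMComparison [MeasurableSpace X] [BorelSpace X] (m : ℕ) : Prop :=
  ∀ F O : Set X, IsClosed F → IsOpen O →
    (∀ μ ∈ invariantMeasures G X, (μ : Measure X) F < (μ : Measure X) O) → SubequivM G m F O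

variable (X) in
/-- Dynamical comparison. -/
def HasComparison [MeasurableSpace X] [BorelSpace X] : Prop := HasMComparison G X 0

end Comparison

section AlmostFinite

/-- The union `S V` of the levels `s V`, `s ∈ S`. -/
def levels {G X : Type*} [Group G] [MulAction G X] (S : Finset G) (V : Set X) : Set X :=
  ⋃ s ∈ S, s • V

/-- `(S, V)` is a tower: its levels `s V`, `s ∈ S`, are pairwise disjoint. -/
def IsTower {G X : Type*} [Group G] [MulAction G X] (S : Finset G) (V : Set X) : Prop :=
  ∀ s ∈ S, ∀ t ∈ S, s ≠ t → Disjoint (s • V) (t • V)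

variable (G X : Type*) [Group G] [MetricSpace X] [MulAction G X]

/-- `m`-almost finiteness: for all `n ≥ 1`, finite `K ⊆ G` and `δ > 0` there are finitely many
towers `(S i, closure (V i))`, with `V i` open, with `(K, δ)`-invariant shapes and levels of
diameter `< δ`, such that the family of the sets `S i (closure (V i))` has chromatic number at most
`m + 1` (witnessed by the colouring `c`), and subsets `S' i ⊆ S i` with `|S' i| ≤ |S i| / n` such
that the complement of `⋃ i, S i V i` is `≺ ⋃ i, S' i V i`. -/
def IsMAlmostFinite (m : ℕ) : Prop :=
  ∀ (n : ℕ), 0 < n → ∀ (K : Finset G) (δ : ℝ), 0 < δ →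
    ∃ (N : ℕ) (S : Fin N → Finset G) (V : Fin N → Set X),
      (∀ i, IsTower (S i) (closure (V i))) ∧
      (∀ i, IsOpen (V i)) ∧
      (∀ i, IsInvariantShape K δ (S i)) ∧
      (∀ i, ∀ s ∈ S i, Metric.diam (s • closure (V i)) < δ) ∧
      (∃ c : Fin N → Fin (m + 1), ∀ i j, i ≠ j → c i = c j →
        Disjoint (levels (S i) (closure (V i))) (levels (S j) (closure (V j)))) ∧
      ∃ S' : Fin N → Finset G,
        (∀ i, S' i ⊆ S i) ∧
        (∀ i, ((S' i).card : ℝ) ≤ ((S i).card : ℝ) / n) ∧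
        SubequivM G 0 (⋃ i, levels (S i) (V i))ᶜ (⋃ i, levels (S' i) (V i))

/-- Almost finiteness. -/
def IsAlmostFinite : Prop := IsMAlmostFinite G X 0

end AlmostFinite

end

noncomputable section

open Filter Topology

universe u v

/-! ### Invariant shapes and the Følner filter -/

/-! The substance lies in (ii) ⇒ (iv), which keeps `m` and so also gives (i) ⇒ (iii), and in (iv) ⇒
(i).

For (ii) ⇒ (iv), weak* compactness turns the inequalities μ(F) < μ(O) into a uniform count
(`exists_visits_add_le`): along every sufficiently invariant shape, each orbit visits O more often
than F, with a surplus proportional to the shape, even after F is thickened and O shrunk. Hence in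
each tower the levels meeting F, together with the few spare levels, inject into the levels inside
O; the remainder travels first to the spare levels and from there into O (`subequivM_of_towers`).

For (iv) ⇒ (i) one needs open castles whose remainder is small for all invariant measures at once.
For a single measure, a Borel quasitiling in the style of Ornstein and Weiss is sliced into disjoint
towers, shrunk to compact bases and fattened to open ones (`exists_isCastle_measureReal_compl_lt`).
The castle still serves nearby ergodic measures, so E_G(X), being compact and zero-dimensional,
splits into finitely many disjoint open parts with one castle each. A mean ergodic theorem uniform
over E_G(X) (`exists_integral_abs_fAvg_sub_lt`) yields nearly invariant continuous functions that
detect, off a set of small measure, which part an ergodic measure belongs to. Cutting the bases down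
to the corresponding open sets makes the castles disjoint
(`exists_isCastle_forall_measureReal_compl_lt`), and a maximum principle
(`exists_mem_ergodicMeasures_le`) passes from ergodic to invariant measures.

Finally, `m`-comparison moves the remainder with `m + 1` colours into a small proportion of the
levels; reserving `m + 1` times as many spare levels gives each colour its own targets
(`HasMComparison.isAlmostFinite`). -/

open scoped Classical in
/-- The elements `s` of `S` with `K s ⊆ S`. -/
def invCore {G : Type*} [Group G] (K S : Finset G) : Finset G :=
  S.filter fun s => ∀ k ∈ K, k * s ∈ S

section Shapes

variable {G : Type*} [Group G] {K K' S : Finset G} {δ δ' : ℝ}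

lemma mem_invCore {s : G} : s ∈ invCore K S ↔ s ∈ S ∧ ∀ k ∈ K, k * s ∈ S := by
  simp [invCore]

lemma invCore_subset : invCore K S ⊆ S := fun _ h => (mem_invCore.1 h).1

lemma isInvariantShape_iff :
    IsInvariantShape K δ S ↔ S.Nonempty ∧ (1 - δ) * (S.card : ℝ) ≤ (invCore K S).card := by
  have h : {s : G | s ∈ S ∧ ∀ k ∈ K, k * s ∈ S} = (invCore K S : Set G) := by
    ext s; simp [mem_invCore]
  rw [IsInvariantShape, h, ncard_coe_finset]

lemma IsInvariantShape.nonempty (h : IsInvariantShape K δ S) : S.Nonempty := h.1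

lemma IsInvariantShape.mono (h : IsInvariantShape K' δ' S) (hK : K ⊆ K') (hδ : δ' ≤ δ) :
    IsInvariantShape K δ S := by
  rw [isInvariantShape_iff] at h ⊢
  refine ⟨h.1, le_trans ?_ (h.2.trans ?_)⟩
  · gcongr
  · norm_cast
    exact Finset.card_le_card fun s hs => mem_invCore.2
      ⟨(mem_invCore.1 hs).1, fun k hk => (mem_invCore.1 hs).2 k (hK hk)⟩

lemma IsInvariantShape.card_sdiff_le [DecidableEq G] (h : IsInvariantShape K δ S) :
    ((S \ invCore K S).card : ℝ) ≤ δ * S.card := by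
  have h1 := (isInvariantShape_iff.1 h).2
  have h2 := Finset.card_sdiff_add_card_eq_card (invCore_subset (K := K) (S := S))
  have h3 : ((S \ invCore K S).card : ℝ) + (invCore K S).card = S.card := by exact_mod_cast h2
  linarith

/-- Since `δ < 1`, some `s` has `K s ⊆ S`. In an infinite group this lets `K` force shapes to be
large. -/
lemma IsInvariantShape.card_le (h : IsInvariantShape K δ S) (hδ : δ < 1) : K.card ≤ S.card := by
  have h1 := (isInvariantShape_iff.1 h).2
  have h2 : (0 : ℝ) < S.card := by exact_mod_cast h.nonempty.card_pos
  have h3 : (0 : ℝ) < (invCore K S).card := lt_of_lt_of_le (by nlinarith) h1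
  obtain ⟨s, hs⟩ := Finset.card_pos.1 (by exact_mod_cast h3 : 0 < (invCore K S).card)
  exact Finset.card_le_card_of_injOn (· * s) (fun k hk => (mem_invCore.1 hs).2 k hk)
    (fun a _ b _ hab => mul_right_cancel hab)

variable (G) in
/-- The filter of finite sets generated by the families of `(K, δ)`-invariant shapes. -/
def folner : Filter (Finset G) :=
  ⨅ p ∈ {p : Finset G × ℝ | 0 < p.2}, 𝓟 {S | IsInvariantShape p.1 p.2 S}

lemma hasBasis_folner : (folner G).HasBasis (fun p : Finset G × ℝ => 0 < p.2)
    fun p => {S | IsInvariantShape p.1 p.2 S} := by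
  classical
  refine hasBasis_biInf_principal ?_ ⟨(∅, 1), one_pos (α := ℝ)⟩
  rintro ⟨K, δ⟩ hδ ⟨K', δ'⟩ hδ'
  refine ⟨(K ∪ K', min δ δ'), show (0 : ℝ) < min δ δ' from lt_min hδ hδ', fun S hS => ?_, fun S hS => ?_⟩
  · exact IsInvariantShape.mono hS Finset.subset_union_left (min_le_left _ _)
  · exact IsInvariantShape.mono hS Finset.subset_union_right (min_le_right _ _)

lemma eventually_folner (K : Finset G) {δ : ℝ} (hδ : 0 < δ) :
    ∀ᶠ S in folner G, IsInvariantShape K δ S :=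
  hasBasis_folner.mem_of_mem (i := (K, δ)) hδ

lemma eventually_folner_nonempty : ∀ᶠ S in folner G, S.Nonempty :=
  (eventually_folner ∅ one_pos).mono fun _ h => h.nonempty

lemma IsAmenableGroup.neBot_folner (hG : IsAmenableGroup G) : (folner G).NeBot :=
  hasBasis_folner.neBot_iff.2 fun {p} hp => hG p.1 p.2 hp

end Shapes

/-! ### Averages of functions and measures -/

section Averages

variable {G X : Type*} [Group G] [TopologicalSpace X] [MulAction G X] [ContinuousConstSMul G X]

/-- The average of the translates `x ↦ f (s x)`, `s ∈ S`. -/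
def fAvg (S : Finset G) (f : C(X, ℝ)) : C(X, ℝ) :=
  (S.card : ℝ)⁻¹ • ∑ s ∈ S, f.comp ⟨fun x => s • x, continuous_const_smul s⟩

lemma fAvg_apply (S : Finset G) (f : C(X, ℝ)) (x : X) :
    fAvg S f x = (S.card : ℝ)⁻¹ * ∑ s ∈ S, f (s • x) := by
  simp [fAvg]

/-- With `C` the core of `S`, both `C` and `g C` lie in `S`, and their contributions cancel; each
sum keeps at most `δ |S|` further terms. -/
lemma abs_sum_smul_sub_le {K S : Finset G} {δ : ℝ} (h : IsInvariantShape K δ S) {g : G}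
    (hg : g ∈ K) {f : G → ℝ} {M : ℝ} (hf : ∀ s, |f s| ≤ M) :
    |∑ s ∈ S, f (g * s) - ∑ s ∈ S, f s| ≤ 2 * M * (δ * S.card) := by
  classical
  set C := invCore K S with hC
  have hM : 0 ≤ M := (abs_nonneg _).trans (hf 1)
  have hcard := h.card_sdiff_le
  have hD : (S \ C.image (g * ·)).card = (S \ C).card := by
    have himg : C.image (g * ·) ⊆ S := by
      intro u hu
      obtain ⟨s, hs, rfl⟩ := Finset.mem_image.1 hu
      exact (mem_invCore.1 hs).2 g hg
    rw [Finset.card_sdiff_of_subset himg, Finset.card_sdiff_of_subset invCore_subset,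
      Finset.card_image_of_injective _ (mul_right_injective g)]
  have h1 : ∑ s ∈ S, f (g * s) = ∑ s ∈ S \ C, f (g * s) + ∑ s ∈ C, f (g * s) :=
    (Finset.sum_sdiff invCore_subset).symm
  have h2 : ∑ s ∈ S, f s = ∑ s ∈ S \ C.image (g * ·), f s + ∑ s ∈ C, f (g * s) := by
    rw [← Finset.sum_image (f := f) (g := fun s => g * s)
      (fun a _ b _ hab => mul_left_cancel hab)]
    refine (Finset.sum_sdiff fun u hu => ?_).symm
    obtain ⟨s, hs, rfl⟩ := Finset.mem_image.1 hu
    exact (mem_invCore.1 hs).2 g hg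
  have bound : ∀ (A : Finset G) (k : G → ℝ), (∀ s, |k s| ≤ M) → |∑ s ∈ A, k s| ≤ A.card * M := by
    intro A k hk
    refine (Finset.abs_sum_le_sum_abs _ _).trans ?_
    simpa using Finset.sum_le_card_nsmul A (fun s => |k s|) M (fun s _ => hk s)
  have b1 := bound (S \ C) (fun s => f (g * s)) (fun s => hf _)
  have b2 := bound (S \ C.image (g * ·)) f hf
  rw [hD] at b2
  rw [h1, h2]
  have : |∑ s ∈ S \ C, f (g * s) + ∑ s ∈ C, f (g * s) -
      (∑ s ∈ S \ C.image (g * ·), f s + ∑ s ∈ C, f (g * s))| ≤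
      |∑ s ∈ S \ C, f (g * s)| + |∑ s ∈ S \ C.image (g * ·), f s| := by
    rw [add_sub_add_right_eq_sub]; exact abs_sub _ _
  nlinarith [mul_le_mul_of_nonneg_right hcard hM]

lemma abs_fAvg_comp_sub_le [CompactSpace X] {K S : Finset G} {δ : ℝ} (h : IsInvariantShape K δ S)
    {g : G} (hg : g ∈ K) (f : C(X, ℝ)) (x : X) :
    |fAvg S (f.comp ⟨fun x => g • x, continuous_const_smul g⟩) x - fAvg S f x| ≤
      2 * ‖f‖ * δ := by
  have h0 : (0 : ℝ) < S.card := by exact_mod_cast h.nonempty.card_pos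
  have := abs_sum_smul_sub_le h hg (f := fun s => f (s • x)) (M := ‖f‖)
    (fun s => f.norm_coe_le_norm _)
  rw [fAvg_apply, fAvg_apply, ← mul_sub, abs_mul, abs_of_pos (inv_pos.2 h0),
    inv_mul_le_iff₀ h0]
  simp only [ContinuousMap.comp_apply, ContinuousMap.coe_mk, ← mul_smul]
  linarith

variable [MeasurableSpace X] [BorelSpace X]

/-- The average of the translates `s_* lam`, `s ∈ S`. -/
def avgMeasure (S : Finset G) (lam : Measure X) : Measure X :=
  (S.card : ℝ≥0∞)⁻¹ • ∑ s ∈ S, lam.map (s • ·)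

lemma avgMeasure_apply (S : Finset G) (lam : Measure X) {B : Set X} (hB : MeasurableSet B) :
    avgMeasure S lam B = (S.card : ℝ≥0∞)⁻¹ * ∑ s ∈ S, lam ((s • ·) ⁻¹' B) := by
  simp only [avgMeasure, Measure.smul_apply, smul_eq_mul, Measure.coe_finsetSum, Finset.sum_apply]
  congr 1
  exact Finset.sum_congr rfl fun s _ => Measure.map_apply (measurable_const_smul s) hB

lemma isProbabilityMeasure_avgMeasure {S : Finset G} (hS : S.Nonempty) (lam : Measure X)
    [IsProbabilityMeasure lam] : IsProbabilityMeasure (avgMeasure S lam) := by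
  refine ⟨?_⟩
  rw [avgMeasure_apply S lam MeasurableSet.univ]
  simp only [preimage_univ, measure_univ, Finset.sum_const, nsmul_eq_mul, mul_one]
  exact ENNReal.inv_mul_cancel (by simpa using hS.ne_empty) (by simp)

open scoped Classical in
/-- `avgMeasure` as a probability measure (with value `lam` for empty `S`). -/
def avgPM (S : Finset G) (lam : ProbabilityMeasure X) : ProbabilityMeasure X :=
  if hS : S.Nonempty then ⟨avgMeasure S (lam : Measure X), isProbabilityMeasure_avgMeasure hS (lam : Measure X)⟩
  else lam

lemma coe_avgPM {S : Finset G} (hS : S.Nonempty) (lam : ProbabilityMeasure X) :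
    (avgPM S lam : Measure X) = avgMeasure S lam := by
  simp [avgPM, hS]

lemma mem_invariantMeasures_iff {μ : ProbabilityMeasure X} [HasOuterApproxClosed X] :
    μ ∈ invariantMeasures G X ↔ ∀ (g : G) (f : C(X, ℝ)),
      ∫ x, f (g • x) ∂(μ : Measure X) = ∫ x, f x ∂(μ : Measure X) := by
  constructor
  · intro h g f
    have h' : SMulInvariantMeasure G X (μ : Measure X) := h
    exact (measurePreserving_smul g (μ : Measure X)).integral_comp
      (Homeomorph.smul g).measurableEmbedding _
  · intro h
    refine ⟨fun g s hs => ?_⟩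
    have : (μ : Measure X).map (g • ·) = μ := by
      have : IsFiniteMeasure ((μ : Measure X).map (g • ·)) := inferInstance
      refine ext_of_forall_integral_eq_of_IsFiniteMeasure fun f => ?_
      rw [integral_map (measurable_const_smul g).aemeasurable
        f.continuous.measurable.aestronglyMeasurable]
      exact h g f.toContinuousMap
    conv_rhs => rw [← this]
    rw [Measure.map_apply (measurable_const_smul g) hs]

variable [CompactSpace X]

lemma integrable_continuousMap (f : C(X, ℝ)) (μ : Measure X) [IsFiniteMeasure μ] :
    Integrable f μ :=
  ((BoundedContinuousFunction.mkOfCompact f).integrable μ).congr (by rfl)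

lemma integral_avgPM {S : Finset G} (hS : S.Nonempty) (lam : ProbabilityMeasure X) (f : C(X, ℝ)) :
    ∫ x, f x ∂(avgPM S lam : Measure X) = ∫ x, fAvg S f x ∂(lam : Measure X) := by
  have hi : ∀ s : G, Integrable (fun x => f (s • x)) (lam : Measure X) := fun s =>
    integrable_continuousMap (f.comp ⟨fun x => s • x, continuous_const_smul s⟩) _
  rw [coe_avgPM hS, avgMeasure, integral_smul_measure, integral_finsetSum_measure]
  · simp only [fAvg_apply]
    rw [integral_const_mul, integral_finsetSum _ fun s _ => hi s]
    simp only [ENNReal.toReal_inv, ENNReal.toReal_natCast, smul_eq_mul]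
    congr 1
    refine Finset.sum_congr rfl fun s _ => ?_
    rw [integral_map (measurable_const_smul s).aemeasurable
      f.continuous.measurable.aestronglyMeasurable]
  · intro s _
    have : IsFiniteMeasure ((lam : Measure X).map (s • ·)) := inferInstance
    exact integrable_continuousMap f _

lemma integral_fAvg_of_mem_invariantMeasures [HasOuterApproxClosed X] {μ : ProbabilityMeasure X}
    (hμ : μ ∈ invariantMeasures G X) {S : Finset G} (hS : S.Nonempty) (f : C(X, ℝ)) :
    ∫ x, fAvg S f x ∂(μ : Measure X) = ∫ x, f x ∂(μ : Measure X) := by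
  have hi : ∀ s : G, Integrable (fun x => f (s • x)) (μ : Measure X) := fun s =>
    integrable_continuousMap (f.comp ⟨fun x => s • x, continuous_const_smul s⟩) _
  have h0 : (S.card : ℝ) ≠ 0 := by exact_mod_cast hS.card_ne_zero
  simp only [fAvg_apply]
  rw [integral_const_mul, integral_finsetSum _ fun s _ => hi s,
    Finset.sum_congr rfl fun s _ => mem_invariantMeasures_iff.1 hμ s f]
  simp [h0]

/-- The Krylov–Bogolyubov argument. The defect of invariance is bounded by `2 ‖f‖ δ` whatever
measure is averaged, so `lam` may vary with the index. -/
lemma mem_invariantMeasures_of_tendsto [HasOuterApproxClosed X] {ι : Type*} {l : Filter ι} [l.NeBot]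
    {S : ι → Finset G} (hS : Tendsto S l (folner G)) {lam : ι → ProbabilityMeasure X}
    {ν : ProbabilityMeasure X} (hν : Tendsto (fun i => avgPM (S i) (lam i)) l (𝓝 ν)) :
    ν ∈ invariantMeasures G X := by
  rw [mem_invariantMeasures_iff]
  intro g f
  set fg := f.comp ⟨fun x => g • x, continuous_const_smul g⟩ with hfg
  have ht := ((ProbabilityMeasure.continuous_integral_continuousMap fg).tendsto ν).comp hν
  have ht' := ((ProbabilityMeasure.continuous_integral_continuousMap f).tendsto ν).comp hν
  have hz : Tendsto (fun i => ∫ x, fg x ∂(avgPM (S i) (lam i) : Measure X) -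
      ∫ x, f x ∂(avgPM (S i) (lam i) : Measure X)) l (𝓝 0) := by
    rw [Metric.tendsto_nhds]
    intro ε hε
    have hδ : 0 < ε / (2 * (2 * ‖f‖ + 1)) := by positivity
    filter_upwards [hS.eventually (eventually_folner {g} hδ)] with i hi
    rw [integral_avgPM hi.nonempty, integral_avgPM hi.nonempty,
      ← integral_sub (integrable_continuousMap _ _) (integrable_continuousMap _ _),
      Real.dist_eq, sub_zero]
    have : |∫ x, (fAvg (S i) fg x - fAvg (S i) f x) ∂(lam i : Measure X)| ≤
        2 * ‖f‖ * (ε / (2 * (2 * ‖f‖ + 1))) := by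
      have := norm_integral_le_of_norm_le_const (μ := (lam i : Measure X))
        (f := fun x => fAvg (S i) fg x - fAvg (S i) f x)
        (Eventually.of_forall fun x => abs_fAvg_comp_sub_le hi (Finset.mem_singleton_self g) f x)
      simpa using this
    refine this.trans_lt ?_
    rw [mul_div_assoc', div_lt_iff₀ (by positivity)]
    nlinarith [norm_nonneg f]
  have := tendsto_nhds_unique hz (ht.sub ht')
  simp only [hfg, ContinuousMap.comp_apply, ContinuousMap.coe_mk] at this
  linarith

end Averages

section Semicontinuity

variable {X : Type*} [TopologicalSpace X] [MeasurableSpace X] [OpensMeasurableSpace X]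
  [HasOuterApproxClosed X]

lemma upperSemicontinuous_measure_of_isClosed {F : Set X} (hF : IsClosed F) :
    UpperSemicontinuous fun μ : ProbabilityMeasure X => (μ : Measure X) F := by
  intro μ c hc
  exact eventually_lt_of_limsup_lt ((ProbabilityMeasure.limsup_measure_closed_le_of_tendsto
    (tendsto_id (α := ProbabilityMeasure X) (x := 𝓝 μ)) hF).trans_lt hc)

end Semicontinuity

/-! ### From `m`-almost finiteness to `m`-comparison -/

section Counting

variable {G X : Type*} [Group G] [MulAction G X]

open scoped Classical in
/-- The number of `s ∈ S` with `s x ∈ B`. -/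
def visits (S : Finset G) (x : X) (B : Set X) : ℕ := (S.filter fun s => s • x ∈ B).card

lemma visits_mono (S : Finset G) (x : X) {B C : Set X} (h : B ⊆ C) :
    visits S x B ≤ visits S x C :=
  Finset.card_le_card fun s hs => by
    simp only [Finset.mem_filter] at hs ⊢; exact ⟨hs.1, h hs.2⟩

lemma visits_add_visits_compl (S : Finset G) (x : X) (B : Set X) :
    visits S x B + visits S x Bᶜ = S.card := by
  classical
  simp only [visits, mem_compl_iff]
  convert Finset.card_filter_add_card_filter_not (s := S) (fun s => s • x ∈ B)

variable [MetricSpace X] [CompactSpace X] [MeasurableSpace X] [BorelSpace X]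
  [ContinuousConstSMul G X]

lemma avgPM_dirac_real {S : Finset G} (hS : S.Nonempty) (x : X) {B : Set X}
    (hB : MeasurableSet B) :
    (avgPM S (diracProba x) : Measure X).real B = visits S x B / S.card := by
  classical
  rw [measureReal_def, coe_avgPM hS, avgMeasure_apply _ _ hB]
  have : ∀ s : G, (diracProba x : Measure X) ((s • ·) ⁻¹' B) = if s • x ∈ B then 1 else 0 := by
    intro s
    rw [diracProba_toMeasure_apply' _ (measurable_const_smul s hB)]
    simp [indicator]
  simp only [this, Finset.sum_boole, visits]
  rw [ENNReal.toReal_mul, ENNReal.toReal_inv, ENNReal.toReal_natCast, ENNReal.toReal_natCast,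
    div_eq_inv_mul]

/-- Otherwise the empirical measures of counterexamples, taken along ever more invariant shapes and
ever smaller thickenings, accumulate at an invariant measure `ν`, and the failure of the count
contradicts `ν F < ν O`. -/
lemma exists_visits_add_le {F O : Set X} (hF : IsClosed F)
    (hO : IsOpen O)
    (h : ∀ μ ∈ invariantMeasures G X, (μ : Measure X) F < (μ : Measure X) O) :
    ∃ (K : Finset G) (δ : ℝ), 0 < δ ∧ ∀ S, IsInvariantShape K δ S → ∀ x : X,
      (visits S x (Metric.cthickening δ F) : ℝ) + δ * S.card ≤
        visits S x (Metric.cthickening δ Oᶜ)ᶜ := by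
  classical
  by_contra hcon
  push Not at hcon
  have hpos : ∀ n : ℕ, (0 : ℝ) < 1 / ((n : ℝ) + 1) := fun n => Nat.one_div_pos_of_nat
  choose S hS x hx using fun p : Finset G × ℕ => hcon p.1 (1 / ((p.2 : ℝ) + 1)) (hpos p.2)
  set l : Ultrafilter (Finset G × ℕ) := Ultrafilter.of atTop with hl
  have hlat : (l : Filter (Finset G × ℕ)) ≤ atTop := Ultrafilter.of_le atTop
  have hev : ∀ (K : Finset G) (r : ℝ), 0 < r → ∀ᶠ p in (l : Filter (Finset G × ℕ)),
      K ⊆ p.1 ∧ 1 / ((p.2 : ℝ) + 1) ≤ r := by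
    intro K r hr
    obtain ⟨n, hn⟩ := exists_nat_one_div_lt hr
    refine hlat ?_
    filter_upwards [Ici_mem_atTop (K, n)] with p hp
    refine ⟨hp.1, le_trans ?_ hn.le⟩
    have : (n : ℝ) ≤ p.2 := by exact_mod_cast hp.2
    gcongr
  have hSf : Tendsto S l (folner G) := by
    rw [hasBasis_folner.tendsto_right_iff]
    rintro ⟨K, r⟩ hr
    filter_upwards [hev K r hr] with p hp
    exact (hS p).mono hp.1 hp.2
  let lam : Finset G × ℕ → ProbabilityMeasure X := fun p => diracProba (x p)
  let ν := (l.map fun p => avgPM (S p) (lam p)).lim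
  have hν : Tendsto (fun p => avgPM (S p) (lam p)) l (𝓝 ν) :=
    Ultrafilter.le_nhds_lim (l.map fun p => avgPM (S p) (lam p))
  have hνinv := mem_invariantMeasures_of_tendsto hSf hν
  have hFO := h ν hνinv
  have key : ∀ C : Set X, IsClosed C → Tendsto
      (fun r => (ν : Measure X).real (Metric.cthickening r C)) (𝓝 0) (𝓝 ((ν : Measure X).real C)) :=
    fun C hC => (ENNReal.tendsto_toReal (measure_ne_top _ _)).comp
      (tendsto_measure_cthickening_of_isClosed ⟨1, one_pos, measure_ne_top _ _⟩ hC)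
  -- Passing to complements leaves only closed sets, for which upper semicontinuity suffices. The
  -- term `2 * 0` is `2 * r` at `r = 0`: it will pay for two errors `r / 2` and for the surplus,
  -- which is at most `r`.
  have hlt : (ν : Measure X).real F + (ν : Measure X).real Oᶜ + 2 * 0 < 1 := by
    rw [probReal_compl_eq_one_sub hO.measurableSet]
    have : (ν : Measure X).real F < (ν : Measure X).real O :=
      (ENNReal.toReal_lt_toReal (measure_ne_top _ _) (measure_ne_top _ _)).2 hFO
    linarith
  have hevr := (((key F hF).add (key Oᶜ hO.isClosed_compl)).add
    ((tendsto_id (α := ℝ) (x := 𝓝 0)).const_mul 2)).eventually_lt_const hlt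
  obtain ⟨r, hr, hr0⟩ := ((hevr.filter_mono nhdsWithin_le_nhds).and
    (self_mem_nhdsWithin (s := Ioi (0 : ℝ)))).exists
  have hr0 : 0 < r := hr0
  have usc : ∀ C : Set X, IsClosed C → ∀ᶠ p in (l : Filter (Finset G × ℕ)),
      (avgPM (S p) (lam p) : Measure X).real C < (ν : Measure X).real C + r / 2 := by
    intro C hC
    have h1 : (ν : Measure X) C < ENNReal.ofReal ((ν : Measure X).real C + r / 2) := by
      rw [measureReal_def, ENNReal.lt_ofReal_iff_toReal_lt (measure_ne_top _ _)]
      linarith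
    filter_upwards [hν.eventually (upperSemicontinuous_measure_of_isClosed hC ν _ h1)] with p hp
    rwa [ENNReal.lt_ofReal_iff_toReal_lt (measure_ne_top _ _)] at hp
  obtain ⟨p, h1, h2, -, h3⟩ := ((usc _ (Metric.isClosed_cthickening (δ := r) (E := F))).and
    ((usc _ (Metric.isClosed_cthickening (δ := r) (E := Oᶜ))).and (hev ∅ r hr0))).exists
  have hne := (hS p).nonempty
  have hc : (0 : ℝ) < (S p).card := by exact_mod_cast hne.card_pos
  rw [avgPM_dirac_real hne (x p) Metric.isClosed_cthickening.measurableSet] at h1 h2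
  have h4 : (visits (S p) (x p) (Metric.cthickening r F) : ℝ) / (S p).card +
      visits (S p) (x p) (Metric.cthickening r Oᶜ) / (S p).card + r < 1 := by
    simp only [id] at hr
    linarith
  rw [← add_div, div_add' _ _ _ hc.ne', div_lt_one hc] at h4
  have h5 := hx p
  have m1 : (visits (S p) (x p) (Metric.cthickening (1 / ((p.2 : ℝ) + 1)) F) : ℝ) ≤
      visits (S p) (x p) (Metric.cthickening r F) := by
    exact_mod_cast visits_mono _ _ (Metric.cthickening_mono h3 _)
  have m2 : (visits (S p) (x p) (Metric.cthickening r Oᶜ)ᶜ : ℝ) ≤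
      visits (S p) (x p) (Metric.cthickening (1 / ((p.2 : ℝ) + 1)) Oᶜ)ᶜ := by
    exact_mod_cast visits_mono _ _ (compl_subset_compl.2 (Metric.cthickening_mono h3 _))
  have m3 : (visits (S p) (x p) (Metric.cthickening r Oᶜ) : ℝ) +
      visits (S p) (x p) (Metric.cthickening r Oᶜ)ᶜ = (S p).card := by
    exact_mod_cast visits_add_visits_compl _ _ _
  have m4 := mul_le_mul_of_nonneg_right h3 hc.le
  linarith

end Counting

/-! ### Assembling subequivalences from towers -/

section Subequivalence

variable {G X : Type*} [Group G]

lemma subequivM_of_finite [TopologicalSpace X] [MulAction G X] {m : ℕ} {F O : Set X} {ι : Type*}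
    [Finite ι] (U : ι → Set X) (s : ι → G)
    (c : ι → Fin (m + 1)) (hU : ∀ j, IsOpen (U j)) (hF : F ⊆ ⋃ j, U j) (hO : ∀ j, s j • U j ⊆ O)
    (hd : ∀ j k, j ≠ k → c j = c k → Disjoint (s j • U j) (s k • U k)) : SubequivM G m F O := by
  obtain ⟨n, ⟨e⟩⟩ := Finite.exists_equiv_fin ι
  refine ⟨n, U ∘ e.symm, s ∘ e.symm, c ∘ e.symm, fun j => hU _, ?_, fun j => hO _,
    fun j k hjk => hd _ _ (e.symm.injective.ne hjk)⟩
  intro x hx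
  obtain ⟨j, hj⟩ := mem_iUnion.1 (hF hx)
  exact mem_iUnion.2 ⟨e j, by simpa using hj⟩

lemma smul_subset_levels [MulAction G X] {S : Finset G} {V : Set X} {s : G} (hs : s ∈ S) :
    s • V ⊆ levels S V :=
  subset_biUnion_of_mem (u := fun s => s • V) (Finset.mem_coe.2 hs)

lemma levels_mono [MulAction G X] {S T : Finset G} {V W : Set X} (hS : S ⊆ T) (hV : V ⊆ W) :
    levels S V ⊆ levels T W :=
  iUnion₂_subset fun _ hs => (smul_set_mono hV).trans (smul_subset_levels (hS hs))

lemma mem_levels [MulAction G X] {S : Finset G} {V : Set X} {x : X} :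
    x ∈ levels S V ↔ ∃ s ∈ S, ∃ v ∈ V, s • v = x := by
  simp [levels, mem_smul_set]

lemma IsTower.mono [MulAction G X] {S T : Finset G} {V W : Set X} (h : IsTower T W) (hS : S ⊆ T)
    (hV : V ⊆ W) : IsTower S V :=
  fun s hs t ht hst => (h s (hS hs) t (hS ht) hst).mono (smul_set_mono hV) (smul_set_mono hV)

lemma dist_lt_of_mem_of_diam_lt [MetricSpace X] [CompactSpace X] {A : Set X} {x y : X} {δ : ℝ}
    (hA : Metric.diam A < δ) (hx : x ∈ A) (hy : y ∈ A) : dist x y < δ :=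
  (Metric.dist_le_diam_of_mem Metric.isBounded_of_compactSpace hx hy).trans_lt hA

/-- If in every tower the levels meeting `F` together with the spare levels `S' i` inject into the
levels contained in `O`, then a subequivalence of the remainder into the spare levels extends to
a subequivalence of `F` into `O`. -/
lemma subequivM_of_towers [TopologicalSpace X] [MulAction G X] [ContinuousConstSMul G X]
    {m N : ℕ} {F O : Set X} {S S' : Fin N → Finset G} {V : Fin N → Set X}
    {c : Fin N → Fin (m + 1)} (ht : ∀ i, IsTower (S i) (closure (V i))) (hV : ∀ i, IsOpen (V i))
    (hc : ∀ i j, i ≠ j → c i = c j →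
      Disjoint (levels (S i) (closure (V i))) (levels (S j) (closure (V j))))
    (hrem : SubequivM G 0 (⋃ i, levels (S i) (V i))ᶜ (⋃ i, levels (S' i) (V i)))
    {M Q : Fin N → Finset G} (hM : ∀ i, ∀ s ∈ S i, (s • closure (V i) ∩ F).Nonempty → s ∈ M i)
    (hQS : ∀ i, Q i ⊆ S i) (hQ : ∀ i, ∀ s ∈ Q i, s • closure (V i) ⊆ O)
    (hcard : ∀ i, (M i).card + (S' i).card ≤ (Q i).card) : SubequivM G m F O := by
  classical
  obtain ⟨L, U, g, cU, hUo, hUc, hUO, hUd⟩ := hrem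
  have hφ : ∀ i, Nonempty ((M i ⊕ S' i) ↪ Q i) := fun i =>
    Function.Embedding.nonempty_of_card_le (by simpa using hcard i)
  let φ : ∀ i, (M i ⊕ S' i) ↪ Q i := fun i => (hφ i).some
  -- There is one piece for every level in `M i`, and one for every spare level and every `U l`: the
  -- part of `U l` that `g l` carries into that spare level. The target level of a piece is chosen
  -- by `φ`.
  let J := Σ i, (M i ⊕ (S' i × Fin L))
  let β : ∀ i, M i ⊕ (S' i × Fin L) → M i ⊕ S' i := fun i => Sum.map id Prod.fst
  let W : J → Set X := fun j => Sum.elim (fun s : M j.1 => (s : G) • V j.1)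
    (fun p : S' j.1 × Fin L => U p.2 ∩ (g p.2)⁻¹ • ((p.1 : G) • V j.1)) j.2
  let a : J → G := fun j => Sum.elim (fun s : M j.1 => (φ j.1 (Sum.inl s) : G) * (s : G)⁻¹)
    (fun p : S' j.1 × Fin L => (φ j.1 (Sum.inr p.1) : G) * (p.1 : G)⁻¹ * g p.2) j.2
  have hW : ∀ j, a j • W j ⊆ (φ j.1 (β j.1 j.2) : G) • V j.1 := by
    rintro ⟨i, s | ⟨s, l⟩⟩
    · simp only [a, W, β, Sum.elim_inl, Sum.map_inl, id, smul_smul, inv_mul_cancel_right]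
      exact subset_rfl
    · simp only [a, W, β, Sum.elim_inr, Sum.map_inr]
      refine (smul_set_mono inter_subset_right).trans ?_
      simp only [smul_smul, mul_assoc, mul_inv_cancel_left, inv_mul_cancel, mul_one]
      exact subset_rfl
  have hQm : ∀ i b, (φ i b : G) ∈ Q i := fun i b => (φ i b).2
  refine subequivM_of_finite W a (fun j => c j.1) ?_ ?_ ?_ ?_
  · rintro ⟨i, s | ⟨s, l⟩⟩
    · exact (hV i).smul _
    · exact (hUo l).inter (((hV i).smul _).smul _)
  · intro x hx
    by_cases hxt : x ∈ ⋃ i, levels (S i) (V i)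
    · obtain ⟨i, hi⟩ := mem_iUnion.1 hxt
      obtain ⟨s, hs, v, hv, rfl⟩ := mem_levels.1 hi
      have hsM := hM i s hs ⟨s • v, smul_mem_smul_set (subset_closure hv), hx⟩
      exact mem_iUnion.2 ⟨⟨i, Sum.inl ⟨s, hsM⟩⟩, smul_mem_smul_set hv⟩
    · obtain ⟨l, hl⟩ := mem_iUnion.1 (hUc hxt)
      obtain ⟨i, hi⟩ := mem_iUnion.1 (hUO l (smul_mem_smul_set hl))
      obtain ⟨s, hs, v, hv, hsv⟩ := mem_levels.1 hi
      refine mem_iUnion.2 ⟨⟨i, Sum.inr (⟨s, hs⟩, l)⟩, hl, ?_⟩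
      rw [mem_inv_smul_set_iff, ← hsv]
      exact smul_mem_smul_set hv
  · rintro ⟨i, b⟩
    exact (hW ⟨i, b⟩).trans ((smul_set_mono subset_closure).trans (hQ i _ (hQm i _)))
  · rintro ⟨i, b⟩ ⟨i', b'⟩ hne hcc
    by_cases hii : i = i'
    · subst hii
      have hbb : b ≠ b' := fun h => hne (by rw [h])
      by_cases hβ : β i b = β i b'
      · rcases b with s | ⟨s, l⟩ <;> rcases b' with s' | ⟨s', l'⟩
        · simp only [β, Sum.map_inl, id, Sum.inl.injEq] at hβ
          exact absurd (congrArg Sum.inl hβ) hbb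
        · simp [β] at hβ
        · simp [β] at hβ
        · simp only [β, Sum.map_inr, Sum.inr.injEq] at hβ
          subst hβ
          -- Pieces sharing a target come from the same spare level, where the translates of
          -- distinct `U l` are already disjoint.
          have hll : l ≠ l' := fun h => hbb (by rw [h])
          simp only [a, W, Sum.elim_inr]
          rw [mul_smul _ (g l), mul_smul _ (g l'), disjoint_smul_set]
          exact (hUd l l' hll (Subsingleton.elim (α := Fin 1) _ _)).mono (smul_set_mono inter_subset_left)
            (smul_set_mono inter_subset_left)
      · refine (ht i _ (hQS i (hQm i (β i b))) _ (hQS i (hQm i (β i b'))) ?_).mono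
          ((hW ⟨i, b⟩).trans (smul_set_mono subset_closure))
          ((hW ⟨i, b'⟩).trans (smul_set_mono subset_closure))
        exact fun h => hβ ((φ i).injective (Subtype.ext h))
    · exact (hc i i' hii hcc).mono
        ((hW ⟨i, b⟩).trans ((smul_subset_levels (hQS i (hQm i _))).trans
          (levels_mono subset_rfl subset_closure)))
        ((hW ⟨i', b'⟩).trans ((smul_subset_levels (hQS i' (hQm i' _))).trans
          (levels_mono subset_rfl subset_closure)))

end Subequivalence

section AlmostFiniteComparison

variable {G X : Type*} [Group G] [MetricSpace X] [CompactSpace X] [MeasurableSpace X]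
  [BorelSpace X] [MulAction G X] [ContinuousConstSMul G X]

/-- Levels have diameter less than `δ`, so a single point of the base counts the levels meeting `F`
and those inside `O` through the `δ`-thickenings; the surplus `δ |S i|` has room for the spare
levels. -/
lemma IsMAlmostFinite.hasMComparison {m : ℕ} (h : IsMAlmostFinite G X m) :
    HasMComparison G X m := by
  classical
  intro F O hF hO hFO
  obtain ⟨K, δ, hδ, hvis⟩ := exists_visits_add_le hF hO hFO
  obtain ⟨n, hn⟩ := exists_nat_one_div_lt hδ
  obtain ⟨N, S, V, ht, hV, hinv, hdiam, ⟨c, hc⟩, S', hS', hS'c, hrem⟩ :=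
    h (n + 1) n.succ_pos K δ hδ
  refine subequivM_of_towers ht hV hc hrem
    (M := fun i => (S i).filter fun s => (s • closure (V i) ∩ F).Nonempty)
    (Q := fun i => (S i).filter fun s => s • closure (V i) ⊆ O)
    (fun i s hs h => Finset.mem_filter.2 ⟨hs, h⟩) (fun i => Finset.filter_subset _ _)
    (fun i s hs => (Finset.mem_filter.1 hs).2) fun i => ?_
  -- With an empty base no level meets `F` and every level lies in `O`.
  rcases (V i).eq_empty_or_nonempty with he | ⟨x, hx⟩
  · simpa [he] using Finset.card_le_card (hS' i)
  · have hv := hvis (S i) (hinv i) x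
    have h1 : ((S i).filter fun s => (s • closure (V i) ∩ F).Nonempty).card ≤
        visits (S i) x (Metric.cthickening δ F) := by
      refine Finset.card_le_card fun s hs => ?_
      obtain ⟨hs, y, hy, hyF⟩ := Finset.mem_filter.1 hs
      refine Finset.mem_filter.2 ⟨hs, Metric.mem_cthickening_of_dist_le _ y _ _ hyF ?_⟩
      exact (dist_lt_of_mem_of_diam_lt (hdiam i s hs)
        (smul_mem_smul_set (subset_closure hx)) hy).le
    have h2 : visits (S i) x (Metric.cthickening δ Oᶜ)ᶜ ≤
        ((S i).filter fun s => s • closure (V i) ⊆ O).card := by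
      refine Finset.card_le_card fun s hs => ?_
      simp only [Finset.mem_filter] at hs
      obtain ⟨hs, hsx⟩ := hs
      refine Finset.mem_filter.2 ⟨hs, fun y hy => ?_⟩
      by_contra hyO
      refine hsx (Metric.mem_cthickening_of_dist_le _ y _ _ hyO ?_)
      exact (dist_lt_of_mem_of_diam_lt (hdiam i s hs)
        (smul_mem_smul_set (subset_closure hx)) hy).le
    have h3 : ((S' i).card : ℝ) ≤ δ * (S i).card := by
      refine (hS'c i).trans ?_
      rw [div_eq_inv_mul, inv_eq_one_div]
      push_cast
      gcongr
    have : (((S i).filter fun s => (s • closure (V i) ∩ F).Nonempty).card : ℝ) + (S' i).card ≤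
        ((S i).filter fun s => s • closure (V i) ⊆ O).card := by
      have h1' : (((S i).filter fun s => (s • closure (V i) ∩ F).Nonempty).card : ℝ) ≤
        visits (S i) x (Metric.cthickening δ F) := by exact_mod_cast h1
      have h2' : (visits (S i) x (Metric.cthickening δ Oᶜ)ᶜ : ℝ) ≤
        ((S i).filter fun s => s • closure (V i) ⊆ O).card := by exact_mod_cast h2
      linarith
    exact_mod_cast this

end AlmostFiniteComparison

/-! ### Borel quasitilings -/

section Quasitiling

variable {G X : Type*} [Group G] [MulAction G X]

/-- `QuasiTiled P ε A` says that `A` is a finite union of Borel towers satisfying `P`, each of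
which has in every column at least the proportion `1 - ε` of its levels outside the union of the
previous ones. -/
inductive QuasiTiled [MeasurableSpace X] (P : Finset G → Set X → Prop) (ε : ℝ) : Set X → Prop
  | empty : QuasiTiled P ε ∅
  | add {A V : Set X} {T : Finset G} (hA : QuasiTiled P ε A) (hP : P T V) (hV : MeasurableSet V)
      (hT : IsTower T V) (hvis : ∀ x ∈ V, (1 - ε) * T.card ≤ visits T x Aᶜ) :
      QuasiTiled P ε (A ∪ levels T V)

/-- The points outside `A` that some element of `T` moves into `A`. -/
def innerBoundary (T : Finset G) (A : Set X) : Set X := {x | x ∉ A ∧ ∃ t ∈ T, t • x ∈ A}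

-- A point outside the new tower that `t₀` moves into its level `t` lies over `t₀⁻¹ t ∉ T`, so `t`
-- is not in the core of `T`.
open scoped Classical in
lemma innerBoundary_union_levels_subset (T₀ T : Finset G) (A V : Set X) :
    innerBoundary T₀ (A ∪ levels T V) ⊆ innerBoundary T₀ A ∪
      levels ((T₀ ×ˢ (T \ invCore (T₀.image (·⁻¹)) T)).image fun p => p.1⁻¹ * p.2) V := by
  rintro x ⟨hx, t₀, ht₀, htx⟩
  simp only [mem_union, not_or] at hx htx
  rcases htx with htx | htx
  · exact Or.inl ⟨hx.1, t₀, ht₀, htx⟩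
  · obtain ⟨t, ht, v, hv, htv⟩ := mem_levels.1 htx
    have hxv : x = (t₀⁻¹ * t) • v := by rw [mul_smul, htv, inv_smul_smul]
    refine Or.inr (mem_levels.2 ⟨t₀⁻¹ * t, Finset.mem_image.2 ⟨(t₀, t), ?_, rfl⟩, v, hv, hxv.symm⟩)
    refine Finset.mem_product.2 ⟨ht₀, Finset.mem_sdiff.2 ⟨ht, fun hcore => hx.2 ?_⟩⟩
    exact mem_levels.2 ⟨_, (mem_invCore.1 hcore).2 _ (Finset.mem_image_of_mem _ ht₀), v, hv,
      hxv.symm⟩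

lemma visits_congr {T : Finset G} {x : X} {B C : Set X} (h : ∀ t ∈ T, t • x ∈ B ↔ t • x ∈ C) :
    visits T x B = visits T x C := by
  classical
  exact congrArg Finset.card (Finset.filter_congr h)

lemma visits_eq_card {T : Finset G} {x : X} {B : Set X} (h : ∀ t ∈ T, t • x ∈ B) :
    visits T x B = T.card := by
  classical
  exact congrArg Finset.card (Finset.filter_true_of_mem h)

lemma visits_eq_sum (T : Finset G) (x : X) (B : Set X) :
    (visits T x B : ℝ) = ∑ t ∈ T, ((t • ·) ⁻¹' B).indicator (fun _ => (1 : ℝ)) x := by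
  classical
  simp [visits, Set.indicator]

variable [MeasurableSpace X]

lemma QuasiTiled.mono {P P' : Finset G → Set X → Prop} {ε : ℝ} {A : Set X}
    (h : QuasiTiled P ε A) (hP : ∀ T V, P T V → P' T V) : QuasiTiled P' ε A := by
  induction h with
  | empty => exact .empty
  | add _ h1 h2 h3 h4 ih => exact .add ih (hP _ _ h1) h2 h3 h4

variable [MeasurableConstSMul G X]

lemma MeasurableSet.levels {T : Finset G} {V : Set X} (hV : MeasurableSet V) :
    MeasurableSet (levels T V) :=
  T.measurableSet_biUnion fun t _ => hV.const_smul t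

lemma measurable_visits (T : Finset G) {B : Set X} (hB : MeasurableSet B) :
    Measurable fun x => (visits T x B : ℝ) := by
  simp only [visits_eq_sum]
  exact Finset.measurable_fun_sum T fun t _ =>
    measurable_const.indicator (measurable_const_smul t hB)

lemma QuasiTiled.measurableSet {P : Finset G → Set X → Prop} {ε : ℝ} {A : Set X}
    (h : QuasiTiled P ε A) : MeasurableSet A := by
  induction h with
  | empty => exact .empty
  | add _ _ hV _ _ ih => exact ih.union hV.levels

/-- Integrate the number of visits over `V`. -/
lemma mul_measureReal_le_sum_of_le_visits (μ : Measure X) [IsFiniteMeasure μ] {T : Finset G}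
    {V B : Set X} (hV : MeasurableSet V) (hB : MeasurableSet B) {c : ℝ}
    (h : ∀ x ∈ V, c ≤ visits T x B) :
    c * μ.real V ≤ ∑ t ∈ T, μ.real (V ∩ (t • ·) ⁻¹' B) := by
  have hi : ∀ t ∈ T, Integrable (((t • ·) ⁻¹' B).indicator (fun _ => (1 : ℝ))) (μ.restrict V) :=
    fun t _ => (integrable_const 1).indicator (measurable_const_smul t hB)
  have h1 : ∫ x in V, (visits T x B : ℝ) ∂μ = ∑ t ∈ T, μ.real (V ∩ (t • ·) ⁻¹' B) := by
    simp only [visits_eq_sum]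
    rw [integral_finsetSum T hi]
    refine Finset.sum_congr rfl fun t _ => ?_
    rw [integral_indicator_const _ (measurable_const_smul t hB),
      measureReal_restrict_apply (measurable_const_smul t hB), inter_comm]
    simp
  rw [← h1, mul_comm, ← smul_eq_mul, ← setIntegral_const]
  refine setIntegral_mono_on (integrable_const c) ?_ hV h
  simp only [visits_eq_sum]
  exact integrable_finsetSum T hi

variable (μ : Measure X) [IsFiniteMeasure μ] [SMulInvariantMeasure G X μ]

lemma measureReal_smul_inter (t : G) (V B : Set X) :
    μ.real (t • V ∩ B) = μ.real (V ∩ (t • ·) ⁻¹' B) := by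
  simp only [measureReal_def]
  rw [← measure_preimage_smul μ t (t • V ∩ B)]
  congr 2
  ext x
  simp

lemma measureReal_levels_inter {T : Finset G} {V B : Set X} (hT : IsTower T V)
    (hV : MeasurableSet V) (hB : MeasurableSet B) :
    μ.real (levels T V ∩ B) = ∑ t ∈ T, μ.real (V ∩ (t • ·) ⁻¹' B) := by
  simp only [← measureReal_smul_inter μ, levels, iUnion₂_inter]
  refine measureReal_biUnion_finset (fun s hs t ht hst => ?_) fun t _ => (hV.const_smul t).inter hB
  exact (hT s hs t ht hst).mono inter_subset_left inter_subset_left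

lemma measureReal_levels_le (T : Finset G) (V : Set X) :
    μ.real (levels T V) ≤ T.card * μ.real V := by
  refine (measureReal_biUnion_finset_le T _).trans ?_
  simp [measureReal_def, measure_smul]

lemma mul_measureReal_le_measureReal_diff {T : Finset G} {A V : Set X} {ε : ℝ}
    (hA : MeasurableSet A) (hV : MeasurableSet V) (hT : IsTower T V)
    (hvis : ∀ x ∈ V, (1 - ε) * T.card ≤ visits T x Aᶜ) :
    (1 - ε) * T.card * μ.real V ≤ μ.real (levels T V \ A) := by
  rw [sdiff_eq, measureReal_levels_inter μ hT hV hA.compl]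
  exact mul_measureReal_le_sum_of_le_visits μ hV hA.compl hvis

-- Each added tower enlarges the inner boundary by at most `|T₀| δ |T| μ(V)`, but enlarges the union
-- by at least `|T| μ(V) / 2`, because `ε ≤ 1 / 2`.
open scoped Classical in
lemma QuasiTiled.measureReal_innerBoundary_le {P : Finset G → Set X → Prop} {ε δ : ℝ}
    {T₀ : Finset G} (hε : ε ≤ 1 / 2) (hδ : 0 ≤ δ)
    (hP : ∀ T V, P T V → IsInvariantShape (T₀.image (·⁻¹)) δ T) {A : Set X}
    (hA : QuasiTiled P ε A) :
    μ.real (innerBoundary T₀ A) ≤ 2 * T₀.card * δ * μ.real A := by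
  induction hA with
  | empty => simp [innerBoundary]
  | @add A V T hA h1 hV hT hvis ih =>
    have hAm := hA.measurableSet
    have hgain := mul_measureReal_le_measureReal_diff μ hAm hV hT hvis
    have hunion : μ.real (A ∪ levels T V) = μ.real A + μ.real (levels T V \ A) := by
      rw [← union_sdiff_self, measureReal_union disjoint_sdiff_right (hV.levels.diff hAm)]
    have hle := (measureReal_mono (μ := μ) (innerBoundary_union_levels_subset T₀ T A V)).trans
      (measureReal_union_le _ _)
    refine hle.trans ?_
    have hD : ((((T₀ ×ˢ (T \ invCore (T₀.image (·⁻¹)) T)).image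
        fun p => p.1⁻¹ * p.2).card : ℕ) : ℝ) ≤ T₀.card * (δ * T.card) := by
      refine (Nat.cast_le.2 Finset.card_image_le).trans ?_
      rw [Finset.card_product, Nat.cast_mul]
      gcongr
      exact (hP _ _ h1).card_sdiff_le
    have hlev := (measureReal_levels_le μ _ V).trans
      (mul_le_mul_of_nonneg_right hD (measureReal_nonneg (μ := μ) (s := V)))
    have h5 : T.card * μ.real V ≤ 2 * μ.real (levels T V \ A) := by
      have : 0 ≤ T.card * μ.real V := by positivity
      nlinarith
    have h6 : (0 : ℝ) ≤ T₀.card * δ := by positivity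
    rw [hunion]
    nlinarith [mul_le_mul_of_nonneg_left h5 h6]

/-- If every point has at least the proportion `ε` of its `T`-translates in `A'`, then passing
from `A` to `A'` covers the proportion `ε` of the complement of `A`, up to the inner boundary. -/
lemma mul_le_measureReal_diff_of_le_visits {μ : Measure X} [IsProbabilityMeasure μ]
    [SMulInvariantMeasure G X μ] {T : Finset G} (hT : T.Nonempty) {A A' : Set X} {ε : ℝ}
    (hε : 0 ≤ ε) (hA : MeasurableSet A) (hA' : MeasurableSet A')
    (h : ∀ x, ε * T.card ≤ visits T x A') :
    ε * (1 - μ.real A - μ.real (innerBoundary T A)) ≤ μ.real (A' \ A) := by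
  classical
  have hWm : MeasurableSet {x : X | ∀ t ∈ T, t • x ∉ A} := by
    have : {x : X | ∀ t ∈ T, t • x ∉ A} = ⋂ t ∈ T, (t • ·) ⁻¹' Aᶜ := by ext x; simp
    rw [this]
    exact T.measurableSet_biInter fun t _ => measurable_const_smul t hA.compl
  -- On `W` all visits to `A'` are visits to `A' \ A`; averaging over `T`, invariance of `μ` gives
  -- `ε μ(W) ≤ μ(A' \ A)`.
  set W := {x : X | ∀ t ∈ T, t • x ∉ A} with hW
  have hcover : (univ : Set X) ⊆ A ∪ innerBoundary T A ∪ W := by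
    intro x _
    by_cases hx : x ∈ A
    · exact Or.inl (Or.inl hx)
    by_cases hx' : ∃ t ∈ T, t • x ∈ A
    · exact Or.inl (Or.inr ⟨hx, hx'⟩)
    · push Not at hx'
      exact Or.inr hx'
  have h1 : 1 ≤ μ.real A + μ.real (innerBoundary T A) + μ.real W := by
    have := (measureReal_mono (μ := μ) hcover).trans (measureReal_union_le _ _)
    have h' := measureReal_union_le (μ := μ) A (innerBoundary T A)
    rw [probReal_univ] at this
    linarith
  have h2 : ε * T.card * μ.real W ≤ ∑ t ∈ T, μ.real (W ∩ (t • ·) ⁻¹' (A' \ A)) := by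
    refine mul_measureReal_le_sum_of_le_visits μ hWm (hA'.diff hA) fun x hx => ?_
    rw [visits_congr fun t ht => (by simp [hx t ht] : t • x ∈ A' \ A ↔ t • x ∈ A')]
    exact h x
  have h3 : ∑ t ∈ T, μ.real (W ∩ (t • ·) ⁻¹' (A' \ A)) ≤ T.card * μ.real (A' \ A) := by
    rw [← nsmul_eq_mul, ← Finset.sum_const]
    refine Finset.sum_le_sum fun t _ => (measureReal_mono inter_subset_right).trans (le_of_eq ?_)
    simp only [measureReal_def, measure_preimage_smul]
  have h4 : (0 : ℝ) < T.card := by exact_mod_cast hT.card_pos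
  have h5 : ε * μ.real W ≤ μ.real (A' \ A) := by
    have : T.card * (ε * μ.real W) ≤ T.card * μ.real (A' \ A) := by linarith
    exact le_of_mul_le_mul_left this h4
  nlinarith

/-- Greedy choice: for each `j`, add the tower over those points of `B j` whose column is still free
in proportion at least `1 - ε`. The columns passed over already meet the union in proportion more
than `ε`. -/
lemma QuasiTiled.exists_superset_le_visits {P : Finset G → Set X → Prop} {ε : ℝ}
    (hε1 : ε ≤ 1) {A : Set X} (hA : QuasiTiled P ε A) {T : Finset G} {κ : Type*} (J : Finset κ)
    {B : κ → Set X} (hB : ∀ j, MeasurableSet (B j)) (hT : ∀ j, IsTower T (B j))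
    (hP : ∀ j, ∀ V ⊆ B j, P T V) :
    ∃ A', A ⊆ A' ∧ QuasiTiled P ε A' ∧ ∀ j ∈ J, ∀ x ∈ B j, ε * T.card ≤ visits T x A' := by
  classical
  induction J using Finset.induction_on with
  | empty => exact ⟨A, subset_rfl, hA, by simp⟩
  | insert j J _ ih =>
    obtain ⟨A₁, hAA₁, hA₁, hvis⟩ := ih
    have hm := measurable_visits T hA₁.measurableSet.compl
    set V := {x ∈ B j | (1 - ε) * T.card ≤ visits T x A₁ᶜ} with hV
    have hVm : MeasurableSet V := (hB j).inter (measurableSet_le measurable_const hm)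
    have hVB : V ⊆ B j := sep_subset _ _
    refine ⟨A₁ ∪ levels T V, hAA₁.trans subset_union_left,
      .add hA₁ (hP j V hVB) hVm ((hT j).mono subset_rfl hVB) fun x hx => hx.2, ?_⟩
    intro i hi x hx
    rcases Finset.mem_insert.1 hi with rfl | hi
    · by_cases hxV : x ∈ V
      · have : visits T x (A₁ ∪ levels T V) = T.card :=
          visits_eq_card fun t ht => Or.inr (mem_levels.2 ⟨t, ht, x, hxV, rfl⟩)
        rw [this]
        exact mul_le_of_le_one_left (Nat.cast_nonneg _) hε1
      · have h1 : (visits T x A₁ᶜ : ℝ) < (1 - ε) * T.card := by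
          by_contra hcon
          exact hxV ⟨hx, not_lt.1 hcon⟩
        have h2 : (visits T x A₁ : ℝ) + visits T x A₁ᶜ = T.card := by
          exact_mod_cast visits_add_visits_compl T x A₁
        have h3 : (visits T x A₁ : ℝ) ≤ visits T x (A₁ ∪ levels T V) := by
          exact_mod_cast visits_mono T x subset_union_left
        linarith
    · refine (hvis i hi x hx).trans ?_
      exact_mod_cast visits_mono T x subset_union_left

end Quasitiling

/-! ### Quasitilings of free actions -/

section Freeness

variable {G X : Type*} [Group G] [MulAction G X] [MetricSpace X] [ContinuousConstSMul G X]

lemma IsFreeAction.exists_isOpen_isTower (hfree : IsFreeAction G X) (T : Finset G) {r : ℝ}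
    (hr : 0 < r) (x : X) :
    ∃ B : Set X, IsOpen B ∧ x ∈ B ∧ IsTower T B ∧ ∀ t ∈ T, ∀ V ⊆ B, Metric.diam (t • V) < r := by
  have h1 : ∀ᶠ U in (𝓝 x).smallSets, ∀ s ∈ T, ∀ t ∈ T, s ≠ t → Disjoint (s • U) (t • U) := by
    simp only [Filter.eventually_all_finset]
    intro s _ t _
    by_cases hst : s = t
    · exact Eventually.of_forall fun U h => absurd hst h
    have hne : s • x ≠ t • x := fun h => hst <| by
      have : (t⁻¹ * s) • x = x := by rw [mul_smul, h, inv_smul_smul]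
      have := hfree _ _ this
      rwa [inv_mul_eq_one, eq_comm] at this
    obtain ⟨U₁, U₂, hU₁, hU₂, hx₁, hx₂, hd⟩ := t2_separation hne
    have hO : (s • ·) ⁻¹' U₁ ∩ (t • ·) ⁻¹' U₂ ∈ 𝓝 x :=
      inter_mem ((continuous_const_smul s).continuousAt.preimage_mem_nhds (hU₁.mem_nhds hx₁))
        ((continuous_const_smul t).continuousAt.preimage_mem_nhds (hU₂.mem_nhds hx₂))
    refine eventually_smallSets.2 ⟨_, hO, fun U hU _ => hd.mono ?_ ?_⟩
    · rintro _ ⟨u, hu, rfl⟩; exact (hU hu).1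
    · rintro _ ⟨u, hu, rfl⟩; exact (hU hu).2
  have h2 : ∀ᶠ U in (𝓝 x).smallSets, ∀ t ∈ T, ∀ V ⊆ U, Metric.diam (t • V) < r := by
    simp only [Filter.eventually_all_finset]
    intro t _
    have hO : (t • ·) ⁻¹' Metric.ball (t • x) (r / 3) ∈ 𝓝 x :=
      (continuous_const_smul t).continuousAt.preimage_mem_nhds
        (Metric.ball_mem_nhds _ (by positivity))
    refine eventually_smallSets.2 ⟨_, hO, fun U hU V hV => ?_⟩
    have hsub : t • V ⊆ Metric.ball (t • x) (r / 3) := by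
      rintro _ ⟨u, hu, rfl⟩; exact hU (hV hu)
    have := (Metric.diam_mono hsub Metric.isBounded_ball).trans
      (Metric.diam_ball (x := t • x) (r := r / 3) (by positivity))
    linarith
  obtain ⟨U, hU, h⟩ := eventually_smallSets.1 (h1.and h2)
  obtain ⟨B, hBU, hB, hxB⟩ := mem_nhds_iff.1 hU
  exact ⟨B, hB, hxB, (h B hBU).1, (h B hBU).2⟩

variable [CompactSpace X] [MeasurableSpace X] [BorelSpace X]

/-- Each round covers about the proportion `ε` of what is left. The shape `T` of the last round is
fixed first, and the earlier rounds are then required to be so invariant under `T⁻¹` that the inner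
`T`-boundary of their union is negligible; hence the induction runs over all `K` and `δ`. The
construction does not see the measure, so one set serves all of them. -/
lemma exists_quasiTiled (hG : IsAmenableGroup G) (hfree : IsFreeAction G X) {ε η r : ℝ}
    (hε : 0 < ε) (hε2 : ε ≤ 1 / 2) (hη : 0 < η) (hr : 0 < r) (N : ℕ) :
    ∀ (K : Finset G) (δ : ℝ), 0 < δ → ∃ A : Set X,
      QuasiTiled (fun T V => IsInvariantShape K δ T ∧ ∀ t ∈ T, Metric.diam (t • V) < r) ε A ∧
      ∀ μ ∈ invariantMeasures G X, (μ : Measure X).real Aᶜ ≤ (1 - ε) ^ N + η := by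
  classical
  induction N with
  | zero =>
    refine fun K δ _ => ⟨∅, .empty, fun μ _ => ?_⟩
    simp [hη.le]
  | succ N ih =>
    intro K δ hδ
    obtain ⟨T, hT⟩ := hG K δ hδ
    have hTc : (0 : ℝ) < T.card := by exact_mod_cast hT.nonempty.card_pos
    have hδ' : 0 < min δ (η / (2 * T.card)) := lt_min hδ (by positivity)
    obtain ⟨A, hA, hAμ⟩ := ih (K ∪ T.image (·⁻¹)) _ hδ'
    choose B hBo hxB hBt hBd using hfree.exists_isOpen_isTower (X := X) T hr
    obtain ⟨J, hJ⟩ := isCompact_univ.elim_nhds_subcover B fun x _ => (hBo x).mem_nhds (hxB x)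
    have hA₁ : QuasiTiled (fun T V => IsInvariantShape K δ T ∧ ∀ t ∈ T, Metric.diam (t • V) < r)
        ε A := hA.mono fun S V h =>
      ⟨h.1.mono Finset.subset_union_left (min_le_left _ _), h.2⟩
    obtain ⟨A', hAA', hA', hvis⟩ := hA₁.exists_superset_le_visits (by linarith) J
      (fun x => (hBo x).measurableSet) hBt (fun x V hV => ⟨hT, fun t ht => hBd x t ht V hV⟩)
    refine ⟨A', hA', fun μ hμ => ?_⟩
    have hμ' : SMulInvariantMeasure G X (μ : Measure X) := hμ
    have hb := hA.measureReal_innerBoundary_le (μ : Measure X) (T₀ := T) hε2 hδ'.le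
      fun S V h => h.1.mono Finset.subset_union_right le_rfl
    have hgain := mul_le_measureReal_diff_of_le_visits (μ := (μ : Measure X)) hT.nonempty hε.le
      hA.measurableSet hA'.measurableSet (fun x => by
        obtain ⟨j, hj, hx⟩ := mem_iUnion₂.1 (hJ.2 (mem_univ x))
        exact hvis j hj x hx)
    have h1 := hAμ μ hμ
    rw [probReal_compl_eq_one_sub hA.measurableSet] at h1
    rw [probReal_compl_eq_one_sub hA'.measurableSet]
    rw [measureReal_sdiff hAA' hA.measurableSet] at hgain
    have h2 : 2 * T.card * min δ (η / (2 * T.card)) ≤ η := by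
      calc 2 * T.card * min δ (η / (2 * T.card)) ≤ 2 * T.card * (η / (2 * T.card)) := by
            gcongr; exact min_le_right _ _
        _ = η := by field_simp
    have h3 : (μ : Measure X).real A ≤ 1 := measureReal_le_one
    have h4 : (μ : Measure X).real (innerBoundary T A) ≤ η :=
      hb.trans (by nlinarith [measureReal_nonneg (μ := (μ : Measure X)) (s := A)])
    rw [pow_succ]
    -- The error does not accumulate: `(1 - ε) η + ε η = η`.
    nlinarith [mul_le_mul_of_nonneg_left h4 hε.le]

end Freeness

/-! ### Open castles with small remainder for a single invariant measure -/

section Slicing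

/-- Deleting `R = T \ T'` removes from the core only elements of `R` and of the sets `k⁻¹ R`,
altogether at most `(1 + |K|) ε |T|`. -/
lemma IsInvariantShape.of_subset {G : Type*} [Group G] {K T T' : Finset G} {δ ε : ℝ}
    (hT : IsInvariantShape K (δ / 2) T) (hsub : T' ⊆ T) (hcard : (1 - ε) * T.card ≤ T'.card)
    (hε : ε < 1) (hεK : ε * (1 + K.card) ≤ δ / 2) : IsInvariantShape K δ T' := by
  classical
  have hTc : (0 : ℝ) < T.card := by exact_mod_cast hT.nonempty.card_pos
  have hT'c : (0 : ℝ) < T'.card := lt_of_lt_of_le (mul_pos (by linarith) hTc) hcard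
  rw [isInvariantShape_iff]
  refine ⟨Finset.card_pos.1 (by exact_mod_cast hT'c), ?_⟩
  set R := T \ T' with hR
  have hRc : (R.card : ℝ) ≤ ε * T.card := by
    have : (R.card : ℝ) + T'.card = T.card := by
      exact_mod_cast Finset.card_sdiff_add_card_eq_card hsub
    linarith
  have hcover : invCore K T ⊆ invCore K T' ∪ (R ∪ K.biUnion fun k => R.image (k⁻¹ * ·)) := by
    intro s hs
    obtain ⟨hsT, hsK⟩ := mem_invCore.1 hs
    by_contra hcon
    simp only [Finset.mem_union, not_or, Finset.mem_biUnion, not_exists, not_and] at hcon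
    have hsT' : s ∈ T' := by
      by_contra h
      exact hcon.2.1 (Finset.mem_sdiff.2 ⟨hsT, h⟩)
    refine hcon.1 (mem_invCore.2 ⟨hsT', fun k hk => ?_⟩)
    by_contra h
    exact hcon.2.2 k hk (Finset.mem_image.2
      ⟨k * s, Finset.mem_sdiff.2 ⟨hsK k hk, h⟩, inv_mul_cancel_left k s⟩)
  have h1 : ((invCore K T).card : ℝ) ≤ (invCore K T').card + (1 + K.card) * R.card := by
    have h2 : (K.biUnion fun k => R.image (k⁻¹ * ·)).card ≤ K.card * R.card :=
      Finset.card_biUnion_le_card_mul _ _ _ fun k _ => Finset.card_image_le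
    have h3 := (Finset.card_le_card hcover).trans (Finset.card_union_le _ _)
    have h4 := Finset.card_union_le R (K.biUnion fun k => R.image (k⁻¹ * ·))
    have h5 : (invCore K T).card ≤ (invCore K T').card + (1 + K.card) * R.card := by
      rw [add_mul, one_mul]; omega
    exact_mod_cast h5
  have h2 := (isInvariantShape_iff.1 hT).2
  have h3 : (1 + (K.card : ℝ)) * R.card ≤ δ / 2 * T.card := by
    calc (1 + (K.card : ℝ)) * R.card ≤ (1 + K.card) * (ε * T.card) := by gcongr
      _ = ε * (1 + K.card) * T.card := by ring
      _ ≤ _ := by gcongr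
  have h4 : (T'.card : ℝ) ≤ T.card := by exact_mod_cast Finset.card_le_card hsub
  rcases le_total δ 1 with h | h
  · nlinarith
  · have : (1 - δ) * (T'.card : ℝ) ≤ 0 := mul_nonpos_of_nonpos_of_nonneg (by linarith) hT'c.le
    exact this.trans (Nat.cast_nonneg _)

variable {G : Type u} {X : Type v} [Group G] [MulAction G X] [MeasurableSpace X]
  [MeasurableConstSMul G X]

/-- Slice the base of each added tower by the pattern of levels that avoid the previous union, and
keep just those levels over each slice. This makes the towers disjoint without changing the union.
-/
lemma QuasiTiled.exists_towers {P : Finset G → Set X → Prop} {ε : ℝ} {A : Set X}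
    (hA : QuasiTiled P ε A) :
    ∃ (ι : Type u) (_ : Finite ι) (S : ι → Finset G) (V : ι → Set X),
      (∀ i, MeasurableSet (V i)) ∧
      (∀ i, ∃ T W, P T W ∧ IsTower T W ∧ S i ⊆ T ∧ V i ⊆ W ∧
        (1 - ε) * T.card ≤ (S i).card) ∧
      (∀ i j, i ≠ j → Disjoint (levels (S i) (V i)) (levels (S j) (V j))) ∧
      A = ⋃ i, levels (S i) (V i) := by
  classical
  induction hA with
  | empty => exact ⟨PEmpty, inferInstance, fun _ => ∅, fun _ => ∅, by simp⟩
  | @add A V T hA hP hV hT hvis ih =>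
    obtain ⟨ι, _, S, W, hWm, hW, hd, hAeq⟩ := ih
    have hAm := hA.measurableSet
    let κ := {T' : Finset G // T' ∈ T.powerset.filter fun T' => (1 - ε) * T.card ≤ T'.card}
    have : Finite κ := by dsimp only [κ]; infer_instance
    let VT : κ → Set X := fun T' => {x ∈ V | ∀ t ∈ T, t • x ∈ Aᶜ ↔ t ∈ T'.1}
    have hκ : ∀ T' : κ, T'.1 ⊆ T ∧ (1 - ε) * T.card ≤ T'.1.card := fun T' => by
      simpa using Finset.mem_filter.1 T'.2
    have hVT : ∀ T', VT T' ⊆ V := fun T' => sep_subset _ _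
    have hVTA : ∀ T', Disjoint (levels T'.1 (VT T')) A := by
      intro T'
      rw [Set.disjoint_left]
      intro x hx
      obtain ⟨t, ht, v, hv, rfl⟩ := mem_levels.1 hx
      exact (hv.2 t ((hκ T').1 ht)).2 ht
    refine ⟨ι ⊕ κ, inferInstance, Sum.elim S (fun T' => T'.1), Sum.elim W VT, ?_, ?_, ?_, ?_⟩
    · rintro (i | T')
      · exact hWm i
      · have : VT T' = V ∩ ⋂ t ∈ T, {x | t • x ∈ Aᶜ ↔ t ∈ T'.1} := by
          ext x; simp [VT]
        simp only [Sum.elim_inr, this]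
        refine hV.inter (T.measurableSet_biInter fun t _ => ?_)
        by_cases ht : t ∈ T'.1
        · convert measurable_const_smul t hAm.compl using 1
          ext x; simp [ht]
        · convert measurable_const_smul t hAm using 1
          ext x; simp [ht]
    · rintro (i | T')
      · exact hW i
      · exact ⟨T, V, hP, hT, (hκ T').1, hVT T', (hκ T').2⟩
    · have hιA : ∀ i, levels (S i) (W i) ⊆ A := fun i => by
        rw [hAeq]; exact subset_iUnion (fun i => levels (S i) (W i)) i
      rintro (i | T₁) (j | T₂) hne
      · exact hd i j fun h => hne (by rw [h])
      · exact ((hVTA T₂).mono_right (hιA i)).symm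
      · exact (hVTA T₁).mono_right (hιA j)
      · simp only [Sum.elim_inr]
        rw [Set.disjoint_left]
        intro x hx₁ hx₂
        obtain ⟨t₁, ht₁, v₁, hv₁, rfl⟩ := mem_levels.1 hx₁
        obtain ⟨t₂, ht₂, v₂, hv₂, hvv⟩ := mem_levels.1 hx₂
        -- Levels of the original tower are disjoint, so the level and then the base point agree;
        -- the base point determines its pattern.
        have htt : t₁ = t₂ := by
          by_contra h
          refine Set.disjoint_left.1 (hT t₁ ((hκ T₁).1 ht₁) t₂ ((hκ T₂).1 ht₂) h)
            (smul_mem_smul_set (hVT T₁ hv₁)) ?_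
          rw [← hvv]
          exact smul_mem_smul_set (hVT T₂ hv₂)
        subst htt
        have hvv' : v₂ = v₁ := smul_left_cancel _ hvv
        subst hvv'
        refine hne (congrArg Sum.inr (Subtype.ext (Finset.ext fun t => ?_)))
        constructor
        · intro h; exact (hv₂.2 t ((hκ T₁).1 h)).1 ((hv₁.2 t ((hκ T₁).1 h)).2 h)
        · intro h; exact (hv₁.2 t ((hκ T₂).1 h)).1 ((hv₂.2 t ((hκ T₂).1 h)).2 h)
    · rw [iUnion_sum]
      simp only [Sum.elim_inl, Sum.elim_inr, ← hAeq]
      refine subset_antisymm (union_subset subset_union_left ?_)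
        (union_subset_union_right _ (iUnion_subset fun T' => levels_mono (hκ T').1 (hVT T')))
      intro x hx
      -- For a new point, the pattern `T'` of its base point is an admissible index by `hvis`.
      by_cases hxA : x ∈ A
      · exact Or.inl hxA
      obtain ⟨t, ht, v, hv, rfl⟩ := mem_levels.1 hx
      let T' : Finset G := T.filter fun t => t • v ∈ Aᶜ
      have hT' : T' ∈ T.powerset.filter fun T' => (1 - ε) * T.card ≤ T'.card := by
        refine Finset.mem_filter.2 ⟨Finset.mem_powerset.2 (Finset.filter_subset _ _), ?_⟩
        have : T'.card = visits T v Aᶜ := by simp only [T', visits]; congr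
        rw [this]; exact hvis v hv
      refine Or.inr (mem_iUnion.2 ⟨⟨T', hT'⟩, mem_levels.2 ⟨t, ?_, v, ⟨hv, ?_⟩, rfl⟩⟩)
      · exact Finset.mem_filter.2 ⟨ht, hxA⟩
      · intro s hs
        simp [T', hs]

end Slicing

section Castles

variable {G : Type u} {X : Type v} [Group G] [MulAction G X] [MetricSpace X]

/-- A castle: open towers with pairwise disjoint closures, `(K, δ)`-invariant shapes and levels of
diameter less than `δ`. -/
structure IsCastle (K : Finset G) (δ : ℝ) {ι : Type*} (S : ι → Finset G) (V : ι → Set X) :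
    Prop where
  isTower : ∀ i, IsTower (S i) (closure (V i))
  isOpen : ∀ i, IsOpen (V i)
  shape : ∀ i, IsInvariantShape K δ (S i)
  diam_lt : ∀ i, ∀ s ∈ S i, Metric.diam (s • closure (V i)) < δ
  disjoint : ∀ i j, i ≠ j →
    Disjoint (levels (S i) (closure (V i))) (levels (S j) (closure (V j)))

variable [CompactSpace X] [ContinuousConstSMul G X]

/-- Only finitely many levels occur, so disjointness of compact levels and the strict diameter
bounds survive a common small thickening. -/
lemma exists_isCastle_of_isCompact {K : Finset G} {δ : ℝ} {ι : Type*} [Finite ι]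
    {S : ι → Finset G} {C : ι → Set X} (hC : ∀ i, IsCompact (C i))
    (ht : ∀ i, IsTower (S i) (C i)) (hS : ∀ i, IsInvariantShape K δ (S i))
    (hdiam : ∀ i, ∀ s ∈ S i, Metric.diam (s • C i) < δ)
    (hd : ∀ i j, i ≠ j → Disjoint (levels (S i) (C i)) (levels (S j) (C j))) :
    ∃ V : ι → Set X, (∀ i, C i ⊆ V i) ∧ IsCastle K δ S V := by
  have hdisj : ∀ A B : Set X, IsCompact A → IsCompact B → Disjoint A B →
      ∀ᶠ ρ in 𝓝[>] (0 : ℝ), Disjoint (Metric.thickening ρ A) (Metric.thickening ρ B) := by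
    intro A B hA hB hAB
    obtain ⟨ρ, hρ, h⟩ := hAB.exists_thickenings hA hB.isClosed
    filter_upwards [Ioo_mem_nhdsGT hρ] with r hr
    exact h.mono (Metric.thickening_mono hr.2.le _) (Metric.thickening_mono hr.2.le _)
  have h1 : ∀ᶠ ρ in 𝓝[>] (0 : ℝ), ∀ i, ∀ s ∈ S i, ∀ t ∈ S i, s ≠ t →
      Disjoint (Metric.thickening ρ (s • C i)) (Metric.thickening ρ (t • C i)) := by
    simp only [eventually_all, Filter.eventually_all_finset]
    exact fun i s hs t ht' hst => hdisj _ _ ((hC i).smul s) ((hC i).smul t) (ht i s hs t ht' hst)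
  have h2 : ∀ᶠ ρ in 𝓝[>] (0 : ℝ), ∀ i j, i ≠ j → ∀ s ∈ S i, ∀ t ∈ S j,
      Disjoint (Metric.thickening ρ (s • C i)) (Metric.thickening ρ (t • C j)) := by
    simp only [eventually_all, Filter.eventually_all_finset]
    exact fun i j hij s hs t ht' => hdisj _ _ ((hC i).smul s) ((hC j).smul t)
      ((hd i j hij).mono (smul_subset_levels hs) (smul_subset_levels ht'))
  have h3 : ∀ᶠ ρ in 𝓝[>] (0 : ℝ), ∀ i, ∀ s ∈ S i,
      Metric.diam (Metric.thickening ρ (s • C i)) < δ := by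
    simp only [eventually_all, Filter.eventually_all_finset]
    intro i s hs
    have hpos : 0 < (δ - Metric.diam (s • C i)) / 2 := by have := hdiam i s hs; linarith
    filter_upwards [Ioo_mem_nhdsGT hpos] with r hr
    have := Metric.diam_thickening_le (s • C i) hr.1.le
    linarith [hr.2]
  obtain ⟨ρ, ⟨⟨h1, h2⟩, h3⟩, hρ⟩ :=
    (((h1.and h2).and h3).and (self_mem_nhdsWithin (s := Ioi (0 : ℝ)))).exists
  have hρ : 0 < ρ := hρ
  have hV : ∀ i, ∃ V : Set X, IsOpen V ∧ C i ⊆ V ∧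
      ∀ s ∈ S i, s • closure V ⊆ Metric.thickening ρ (s • C i) := by
    intro i
    have ho : IsOpen (⋂ s ∈ S i, (s • ·) ⁻¹' Metric.thickening ρ (s • C i)) :=
      isOpen_biInter_finset fun s _ =>
        Metric.isOpen_thickening.preimage (continuous_const_smul s)
    have hsub : C i ⊆ ⋂ s ∈ S i, (s • ·) ⁻¹' Metric.thickening ρ (s • C i) :=
      subset_iInter₂ fun s _ x hx =>
        Metric.self_subset_thickening hρ _ (smul_mem_smul_set hx)
    obtain ⟨V, hVo, hCV, hVc⟩ := normal_exists_closure_subset (hC i).isClosed ho hsub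
    refine ⟨V, hVo, hCV, fun s hs => ?_⟩
    rintro _ ⟨x, hx, rfl⟩
    exact mem_iInter₂.1 (hVc hx) s hs
  choose V hVo hCV hVt using hV
  refine ⟨V, hCV, ⟨fun i s hs t ht' hst => ?_, hVo, hS, fun i s hs => ?_, fun i j hij => ?_⟩⟩
  · exact (h1 i s hs t ht' hst).mono (hVt i s hs) (hVt i t ht')
  · exact (Metric.diam_mono (hVt i s hs) Metric.isBounded_of_compactSpace).trans_lt (h3 i s hs)
  · simp only [levels, disjoint_iUnion_left, disjoint_iUnion_right]
    exact fun t ht' s hs => (h2 i j hij s hs t ht').mono (hVt i s hs) (hVt j t ht')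

variable [MeasurableSpace X] [BorelSpace X]

lemma exists_isCastle_measureReal_compl_lt (hG : IsAmenableGroup G) (hfree : IsFreeAction G X)
    (K : Finset G) {δ ε : ℝ} (hδ : 0 < δ) (hε : 0 < ε) {μ : ProbabilityMeasure X}
    (hμ : μ ∈ invariantMeasures G X) :
    ∃ (ι : Type u) (_ : Finite ι) (S : ι → Finset G) (V : ι → Set X), IsCastle K δ S V ∧
      (μ : Measure X).real (⋃ i, levels (S i) (V i))ᶜ < ε := by
  have hμ' : SMulInvariantMeasure G X (μ : Measure X) := hμ
  -- The bound `1 / 2` is for the quasitiling, the other for keeping shapes invariant when they lose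
  -- the proportion `e`. The remainder is at most three times `ε / 3`: from `(1 - e) ^ N`, from the
  -- error term of the quasitiling and from inner regularity.
  set e : ℝ := min (1 / 2) (δ / 2 / (1 + K.card)) with he
  have he0 : 0 < e := lt_min (by norm_num) (by positivity)
  have he2 : e ≤ 1 / 2 := min_le_left _ _
  have heK : e * (1 + K.card) ≤ δ / 2 := by
    rw [← le_div_iff₀ (by positivity)]; exact min_le_right _ _
  obtain ⟨N, hN⟩ := exists_pow_lt_of_lt_one (show 0 < ε / 3 by positivity)
    (show 1 - e < 1 by linarith)
  obtain ⟨A, hA, hAμ⟩ := exists_quasiTiled (X := X) hG hfree he0 he2 (show 0 < ε / 3 by positivity) hδ N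
    K (δ / 2) (by positivity)
  obtain ⟨ι, _, S, V, hVm, hV, hd, hAeq⟩ := hA.exists_towers
  have := Fintype.ofFinite ι
  set τ : ℝ := ε / 3 / (∑ i, ((S i).card : ℝ) + 1) with hτ
  have hsum : (0 : ℝ) < ∑ i, ((S i).card : ℝ) + 1 :=
    add_pos_of_nonneg_of_pos (Finset.sum_nonneg fun i _ => Nat.cast_nonneg _) one_pos
  have hτ0 : 0 < τ := div_pos (by linarith) hsum
  have hC : ∀ i, ∃ C ⊆ V i, IsCompact C ∧ (μ : Measure X).real (V i \ C) ≤ τ := by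
    intro i
    obtain ⟨C, hCV, hC, hlt⟩ := (hVm i).exists_isCompact_sdiff_lt (μ := (μ : Measure X))
      (measure_ne_top _ _) (ε := ENNReal.ofReal τ) (ENNReal.ofReal_pos.2 hτ0).ne'
    exact ⟨C, hCV, hC, ENNReal.toReal_le_of_le_ofReal hτ0.le hlt.le⟩
  choose C hCV hCc hCμ using hC
  choose T W hP hTW hST hVW hcard using hV
  obtain ⟨V', hCV', hcastle⟩ := exists_isCastle_of_isCompact (K := K) (δ := δ) hCc
    (fun i => (hTW i).mono (hST i) ((hCV i).trans (hVW i)))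
    (fun i => (hP i).1.of_subset (hST i) (hcard i) (by linarith) heK)
    (fun i s hs => (Metric.diam_mono (smul_set_mono ((hCV i).trans (hVW i)))
      Metric.isBounded_of_compactSpace).trans_lt ((hP i).2 s (hST i hs)))
    (fun i j hij => (hd i j hij).mono (levels_mono subset_rfl (hCV i))
      (levels_mono subset_rfl (hCV j)))
  refine ⟨ι, ‹_›, S, V', hcastle, ?_⟩
  have hsub : (⋃ i, levels (S i) (V' i))ᶜ ⊆ Aᶜ ∪ ⋃ i, levels (S i) (V i \ C i) := by
    intro x hx
    by_cases hxA : x ∈ A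
    · rw [hAeq] at hxA
      obtain ⟨i, hi⟩ := mem_iUnion.1 hxA
      obtain ⟨s, hs, v, hv, rfl⟩ := mem_levels.1 hi
      refine Or.inr (mem_iUnion.2 ⟨i, mem_levels.2 ⟨s, hs, v, ⟨hv, fun hvC => hx ?_⟩, rfl⟩⟩)
      exact mem_iUnion.2 ⟨i, mem_levels.2 ⟨s, hs, v, hCV' i hvC, rfl⟩⟩
    · exact Or.inl hxA
  have h1 : (μ : Measure X).real (⋃ i, levels (S i) (V i \ C i)) ≤ ε / 3 := by
    refine (measureReal_iUnion_fintype_le _).trans ?_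
    calc ∑ i, (μ : Measure X).real (levels (S i) (V i \ C i))
        ≤ ∑ i, ((S i).card : ℝ) * τ := Finset.sum_le_sum fun i _ =>
          (measureReal_levels_le _ _ _).trans
            (mul_le_mul_of_nonneg_left (hCμ i) (Nat.cast_nonneg _))
      _ = (∑ i, ((S i).card : ℝ)) * τ := by rw [Finset.sum_mul]
      _ ≤ (∑ i, ((S i).card : ℝ) + 1) * τ := mul_le_mul_of_nonneg_right (by linarith) hτ0.le
      _ = ε / 3 := by rw [hτ, mul_comm, div_mul_cancel₀ _ hsum.ne']
  have h2 := hAμ μ hμ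
  have h3 := (measureReal_mono (μ := (μ : Measure X)) hsub).trans (measureReal_union_le _ _)
  linarith

end Castles

/-! ### Ergodic measures -/

section Ergodic

variable {G X : Type*} [Group G] [MetricSpace X] [CompactSpace X] [MeasurableSpace X]
  [BorelSpace X] [MulAction G X] [ContinuousConstSMul G X]

lemma ergodicMeasures_subset : ergodicMeasures G X ⊆ invariantMeasures G X := by
  intro μ hμ
  obtain ⟨ν, hν, hνμ⟩ := extremePoints_subset hμ
  rwa [← ProbabilityMeasure.toMeasure_injective hνμ]

lemma eq_of_forall_integral_eq {μ ν : ProbabilityMeasure X}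
    (h : ∀ f : C(X, ℝ), ∫ x, f x ∂(μ : Measure X) = ∫ x, f x ∂(ν : Measure X)) : μ = ν :=
  ProbabilityMeasure.toMeasure_injective
    (ext_of_forall_integral_eq_of_IsFiniteMeasure fun f => h f.toContinuousMap)

/-- Extremality tested on continuous functions. The value `p = 1` is allowed because `p` will arise
as a limit of measures of sets. -/
lemma eq_of_mem_ergodicMeasures {μ ν κ : ProbabilityMeasure X} (hμ : μ ∈ ergodicMeasures G X)
    (hν : ν ∈ invariantMeasures G X) (hκ : κ ∈ invariantMeasures G X) {p : ℝ} (hp : 0 < p)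
    (hp1 : p ≤ 1)
    (h : ∀ f : C(X, ℝ), ∫ x, f x ∂(μ : Measure X) =
      p * ∫ x, f x ∂(ν : Measure X) + (1 - p) * ∫ x, f x ∂(κ : Measure X)) : ν = μ := by
  rcases hp1.eq_or_lt with rfl | hp1
  · exact (eq_of_forall_integral_eq fun f => by simpa using h f).symm
  refine ProbabilityMeasure.toMeasure_injective
    ((mem_extremePoints.1 hμ).2 _ ⟨ν, hν, rfl⟩ _ ⟨κ, hκ, rfl⟩ ?_).1
  refine ⟨ENNReal.ofReal p, ENNReal.ofReal (1 - p), ENNReal.ofReal_pos.2 hp,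
    ENNReal.ofReal_pos.2 (by linarith), ?_, ?_⟩
  · rw [← ENNReal.ofReal_add hp.le (by linarith)]; simp
  · have i1 : IsFiniteMeasure (ENNReal.ofReal p • (ν : Measure X)) :=
      Measure.smul_finite _ ENNReal.ofReal_ne_top
    have i2 : IsFiniteMeasure (ENNReal.ofReal (1 - p) • (κ : Measure X)) :=
      Measure.smul_finite _ ENNReal.ofReal_ne_top
    refine ext_of_forall_integral_eq_of_IsFiniteMeasure fun f => ?_
    rw [integral_add_measure (f.integrable _) (f.integrable _), integral_smul_measure,
      integral_smul_measure, ENNReal.toReal_ofReal hp.le, ENNReal.toReal_ofReal (by linarith)]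
    exact (h f.toContinuousMap).symm

open scoped Classical in
/-- The conditional probability measure (with value `μ` if `A` is a null set). -/
def condPM (μ : ProbabilityMeasure X) (A : Set X) : ProbabilityMeasure X :=
  if h : (μ : Measure X) A ≠ 0 then
    ⟨ProbabilityTheory.cond (μ : Measure X) A, ProbabilityTheory.cond_isProbabilityMeasure h⟩
  else μ

lemma measureReal_mul_integral_condPM (μ : ProbabilityMeasure X) (A : Set X) (f : X → ℝ) :
    (μ : Measure X).real A * ∫ x, f x ∂(condPM μ A : Measure X) =
      ∫ x in A, f x ∂(μ : Measure X) := by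
  by_cases h : (μ : Measure X) A = 0
  · rw [measureReal_def, h, setIntegral_measure_zero _ h]; simp
  · have hr : (μ : Measure X).real A ≠ 0 := by
      rw [measureReal_def, ENNReal.toReal_ne_zero]; exact ⟨h, measure_ne_top _ _⟩
    have hc : (condPM μ A : Measure X) = ProbabilityTheory.cond (μ : Measure X) A := by
      simp [condPM, h]
    rw [hc, ProbabilityTheory.cond, integral_smul_measure, ENNReal.toReal_inv, smul_eq_mul,
      ← measureReal_def, mul_inv_cancel_left₀ hr]

lemma abs_integral_continuousMap_le (μ : ProbabilityMeasure X) (f : C(X, ℝ)) :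
    |∫ x, f x ∂(μ : Measure X)| ≤ ‖f‖ := by
  simpa using norm_integral_le_of_norm_le_const (μ := (μ : Measure X)) (f := f)
    (Eventually.of_forall f.norm_coe_le_norm)

lemma abs_fAvg_le {S : Finset G} (hS : S.Nonempty) (f : C(X, ℝ)) (x : X) :
    |fAvg S f x| ≤ ‖f‖ := by
  have h0 : (0 : ℝ) < S.card := by exact_mod_cast hS.card_pos
  rw [fAvg_apply, abs_mul, abs_of_pos (inv_pos.2 h0), inv_mul_le_iff₀ h0]
  refine (Finset.abs_sum_le_sum_abs _ _).trans ?_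
  simpa using Finset.sum_le_card_nsmul S (fun s => |f (s • x)|) ‖f‖
    (fun s _ => f.norm_coe_le_norm _)

/-- A lower bound for the measure of the set where a function of mean zero is large. -/
lemma le_mul_measureReal_of_le_integral_abs {μ : ProbabilityMeasure X} {u : X → ℝ} {M ε : ℝ}
    (hu : Integrable u (μ : Measure X)) (hum : Measurable u) (h0 : ∫ x, u x ∂(μ : Measure X) = 0)
    (hM : ∀ x, u x ≤ M) (hε : 0 ≤ ε) (h : ε ≤ ∫ x, |u x| ∂(μ : Measure X)) :
    ε / 4 ≤ M * (μ : Measure X).real {x | ε / 4 < u x} := by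
  have hAm : MeasurableSet {x | ε / 4 < u x} := measurableSet_lt measurable_const hum
  have hi : Integrable ({x | ε / 4 < u x}.indicator fun _ => M) (μ : Measure X) :=
    (integrable_const M).indicator hAm
  have hi2 : Integrable (fun x => 2 * (ε / 4 + {x | ε / 4 < u x}.indicator (fun _ => M) x))
      (μ : Measure X) := ((integrable_const _).add hi).const_mul 2
  have hie : ∫ x, (ε / 4 + {x | ε / 4 < u x}.indicator (fun _ => M) x) ∂(μ : Measure X) =
      ε / 4 + (μ : Measure X).real {x | ε / 4 < u x} * M := by
    have := integral_add (integrable_const (μ := (μ : Measure X)) (ε / 4)) hi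
    rw [integral_indicator_const _ hAm] at this
    simpa using this
  -- Pointwise `|u| + u = 2 max(u, 0)`, and the positive part is at most `ε / 4` plus `M` on the set
  -- where `u > ε / 4`.
  have hle : ∫ x, |u x| ∂(μ : Measure X) ≤
      ∫ x, (2 * (ε / 4 + {x | ε / 4 < u x}.indicator (fun _ => M) x) - u x) ∂(μ : Measure X) := by
    refine integral_mono hu.abs (hi2.sub hu) fun x => ?_
    dsimp only
    by_cases hx : ε / 4 < u x
    · rw [indicator_of_mem (by exact hx)]
      rcases abs_cases (u x) with ⟨h1, _⟩ | ⟨h1, _⟩ <;> rw [h1] <;> linarith [hM x]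
    · rw [indicator_of_notMem (by exact hx)]
      rcases abs_cases (u x) with ⟨h1, _⟩ | ⟨h1, _⟩ <;> rw [h1] <;> linarith [not_lt.1 hx]
  rw [integral_sub hi2 hu, h0, integral_const_mul, hie] at hle
  linarith

/-- The mean ergodic theorem, uniformly over a compact set of ergodic measures. -/
lemma exists_integral_abs_fAvg_sub_lt (hG : IsAmenableGroup G)
    (hE : IsCompact (ergodicMeasures G X)) (f : C(X, ℝ)) {ε : ℝ} (hε : 0 < ε) :
    ∃ S : Finset G, S.Nonempty ∧ ∀ μ ∈ ergodicMeasures G X,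
      ∫ x, |fAvg S f x - ∫ y, f y ∂(μ : Measure X)| ∂(μ : Measure X) < ε := by
  -- Condition the bad ergodic measures on the set `A S` where the average exceeds the mean by `ε /
  -- 4`, and on its complement. Averaged along a Følner ultrafilter, these converge to invariant
  -- measures of which the limit `e₀` is a convex combination, with positive weight on the first.
  -- Extremality of `e₀`, available since the ergodic measures are compact, identifies the first
  -- with `e₀`, although its integral of `f` is larger by `ε / 4`.
  by_contra hcon
  push Not at hcon
  have := hG.neBot_folner
  obtain ⟨S₀, hS₀⟩ := (eventually_folner_nonempty (G := G)).exists
  obtain ⟨μ₀, -, -⟩ := hcon S₀ hS₀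
  have hcon' : ∀ S : Finset G, ∃ μ : ProbabilityMeasure X, S.Nonempty → μ ∈ ergodicMeasures G X ∧
      ε ≤ ∫ x, |fAvg S f x - ∫ y, f y ∂(μ : Measure X)| ∂(μ : Measure X) := by
    intro S
    by_cases hS : S.Nonempty
    · obtain ⟨μ, h⟩ := hcon S hS; exact ⟨μ, fun _ => h⟩
    · exact ⟨μ₀, fun h => absurd h hS⟩
  choose e he using hcon'
  set l : Ultrafilter (Finset G) := Ultrafilter.of (folner G)
  have hl : (l : Filter (Finset G)) ≤ folner G := Ultrafilter.of_le _
  have hne : ∀ᶠ S in (l : Filter (Finset G)), S.Nonempty := hl eventually_folner_nonempty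
  set M : ℝ := 2 * ‖f‖ + 1 with hM
  have hM0 : 0 < M := by positivity
  let A : Finset G → Set X := fun S =>
    {x | ε / 4 < fAvg S f x - ∫ y, f y ∂(e S : Measure X)}
  have hAm : ∀ S, MeasurableSet (A S) := fun S =>
    measurableSet_lt measurable_const ((fAvg S f).continuous.measurable.sub measurable_const)
  let p : Finset G → ℝ := fun S => (e S : Measure X).real (A S)
  have hp : ∀ᶠ S in (l : Filter (Finset G)), p S ∈ Icc (ε / 4 / M) 1 := by
    filter_upwards [hne] with S hS
    refine ⟨?_, measureReal_le_one⟩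
    rw [div_le_iff₀ hM0, mul_comm]
    have hi : Integrable (fun x => fAvg S f x) (e S : Measure X) := integrable_continuousMap _ _
    refine le_mul_measureReal_of_le_integral_abs (hi.sub (integrable_const _))
      ((fAvg S f).continuous.measurable.sub measurable_const) ?_ (fun x => ?_) hε.le
      (he S hS).2
    · rw [integral_sub hi (integrable_const _),
        integral_fAvg_of_mem_invariantMeasures (ergodicMeasures_subset (he S hS).1) hS]
      simp
    · have h1 := (abs_le.1 (abs_fAvg_le hS f x)).2
      have h2 := (abs_le.1 (abs_integral_continuousMap_le (e S) f)).1
      linarith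
  obtain ⟨p₀, hp₀, hpl⟩ := isCompact_Icc.ultrafilter_le_nhds (l.map p) (le_principal_iff.2 hp)
  obtain ⟨e₀, he₀, hel⟩ := hE.ultrafilter_le_nhds (l.map e)
    (le_principal_iff.2 (hne.mono fun S hS => (he S hS).1))
  have hpl : Tendsto p l (𝓝 p₀) := hpl
  have hel : Tendsto e l (𝓝 e₀) := hel
  let ν := (l.map fun S => avgPM S (condPM (e S) (A S))).lim
  let κ := (l.map fun S => avgPM S (condPM (e S) (A S)ᶜ)).lim
  have hν : Tendsto (fun S => avgPM S (condPM (e S) (A S))) l (𝓝 ν) :=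
    Ultrafilter.le_nhds_lim (l.map fun S => avgPM S (condPM (e S) (A S)))
  have hκ : Tendsto (fun S => avgPM S (condPM (e S) (A S)ᶜ)) l (𝓝 κ) :=
    Ultrafilter.le_nhds_lim (l.map fun S => avgPM S (condPM (e S) (A S)ᶜ))
  have hlid : Tendsto id (l : Filter (Finset G)) (folner G) := hl
  have hνi : ν ∈ invariantMeasures G X := mem_invariantMeasures_of_tendsto hlid hν
  have hκi : κ ∈ invariantMeasures G X := mem_invariantMeasures_of_tendsto hlid hκ
  have hint : ∀ (g : C(X, ℝ)) {m : Finset G → ProbabilityMeasure X} {m₀ : ProbabilityMeasure X},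
      Tendsto m l (𝓝 m₀) → Tendsto (fun S => ∫ x, g x ∂(m S : Measure X)) l
        (𝓝 (∫ x, g x ∂(m₀ : Measure X))) := fun g m m₀ hm =>
    ((ProbabilityMeasure.continuous_integral_continuousMap g).tendsto m₀).comp hm
  have hdecomp : ∀ g : C(X, ℝ), ∫ x, g x ∂(e₀ : Measure X) =
      p₀ * ∫ x, g x ∂(ν : Measure X) + (1 - p₀) * ∫ x, g x ∂(κ : Measure X) := by
    intro g
    refine tendsto_nhds_unique (hint g hel) (Tendsto.congr' ?_
      ((hpl.mul (hint g hν)).add ((hpl.const_sub 1).mul (hint g hκ))))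
    filter_upwards [hne] with S hS
    have hpc : 1 - p S = (e S : Measure X).real (A S)ᶜ := (probReal_compl_eq_one_sub (hAm S)).symm
    rw [integral_avgPM hS, integral_avgPM hS, hpc, measureReal_mul_integral_condPM,
      measureReal_mul_integral_condPM, integral_add_compl (hAm S) (integrable_continuousMap _ _),
      integral_fAvg_of_mem_invariantMeasures (ergodicMeasures_subset (he S hS).1) hS]
  have hνe : ν = e₀ := eq_of_mem_ergodicMeasures he₀ hνi hκi
    (lt_of_lt_of_le (by positivity) hp₀.1) hp₀.2 hdecomp
  have hlow : ∫ x, f x ∂(e₀ : Measure X) + ε / 4 ≤ ∫ x, f x ∂(ν : Measure X) := by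
    refine le_of_tendsto_of_tendsto ((hint f hel).add_const (ε / 4)) (hint f hν) ?_
    filter_upwards [hne, hp] with S hS hpS
    rw [integral_avgPM hS]
    have hpS0 : 0 < (e S : Measure X).real (A S) := lt_of_lt_of_le (by positivity) hpS.1
    refine le_of_mul_le_mul_left ?_ hpS0
    rw [measureReal_mul_integral_condPM, ← smul_eq_mul, ← setIntegral_const]
    refine setIntegral_mono_on (integrable_const _).integrableOn
      (integrable_continuousMap _ _).integrableOn (hAm S) fun x hx => ?_
    have hx : ε / 4 < fAvg S f x - ∫ y, f y ∂(e S : Measure X) := hx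
    linarith
  rw [hνe] at hlow
  linarith

/-- A continuous function that is nearly invariant under `K` and close to the mean of `f` with
respect to each ergodic measure. -/
lemma exists_nearly_invariant (hG : IsAmenableGroup G)
    (hE : IsCompact (ergodicMeasures G X)) (f : C(X, ℝ)) (K : Finset G) {ε : ℝ} (hε : 0 < ε) :
    ∃ ψ : C(X, ℝ), (∀ g ∈ K, ∀ x, |ψ (g • x) - ψ x| < ε) ∧ ∀ μ ∈ ergodicMeasures G X,
      ∫ x, |ψ x - ∫ y, f y ∂(μ : Measure X)| ∂(μ : Measure X) < ε := by
  classical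
  obtain ⟨S, hS, hSE⟩ := exists_integral_abs_fAvg_sub_lt hG hE f hε
  set φ := fAvg S f with hφ
  have hδ : 0 < ε / (2 * (2 * ‖φ‖ + 1)) := by positivity
  -- Replacing `x` by `g x` in `φ (s x)` multiplies `s` on the right, which left invariance of a
  -- shape does not control. Averaging over `T⁻¹` instead turns it into left multiplication of `T`
  -- by `g⁻¹`.
  obtain ⟨T, hT⟩ := hG (K.image (·⁻¹)) _ hδ
  have hT0 : (0 : ℝ) < T.card := by exact_mod_cast hT.nonempty.card_pos
  have hTi : (T.image (·⁻¹)).Nonempty := hT.nonempty.image _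
  have hTc : (T.image (·⁻¹)).card = T.card := Finset.card_image_of_injective _ inv_injective
  have hψ : ∀ x, fAvg (T.image (·⁻¹)) φ x = (T.card : ℝ)⁻¹ * ∑ t ∈ T, φ (t⁻¹ • x) := by
    intro x
    rw [fAvg_apply, hTc, Finset.sum_image inv_injective.injOn]
  refine ⟨fAvg (T.image (·⁻¹)) φ, fun g hg x => ?_, fun μ hμ => ?_⟩
  · have h1 := abs_sum_smul_sub_le hT (Finset.mem_image_of_mem (·⁻¹) hg)
      (f := fun s => φ (s⁻¹ • x)) (fun s => φ.norm_coe_le_norm _)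
    simp only [mul_inv_rev, inv_inv, mul_smul] at h1
    rw [hψ, hψ, ← mul_sub, abs_mul, abs_of_pos (inv_pos.2 hT0), inv_mul_lt_iff₀ hT0]
    refine h1.trans_lt ?_
    have h2 : 2 * ‖φ‖ * (ε / (2 * (2 * ‖φ‖ + 1))) < ε := by
      rw [mul_div_assoc', div_lt_iff₀ (by positivity)]
      nlinarith [norm_nonneg φ]
    nlinarith
  · set c := ∫ y, f y ∂(μ : Measure X) with hc
    refine lt_of_le_of_lt ?_ (hSE μ hμ)
    -- By convexity of the absolute value and invariance of `μ`, the second averaging does not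
    -- increase the L¹ distance to `c`.
    have h2 := integral_fAvg_of_mem_invariantMeasures (ergodicMeasures_subset hμ) hTi
      |φ - ContinuousMap.const X c|
    have h3 : ∀ x, (|φ - ContinuousMap.const X c| : C(X, ℝ)) x = |φ x - c| := fun x => rfl
    simp only [h3] at h2
    rw [← h2]
    refine integral_mono ((integrable_continuousMap _ _).sub (integrable_const c)).abs
      (integrable_continuousMap _ _) fun x => ?_
    dsimp only
    rw [hψ, fAvg_apply, hTc, Finset.sum_image inv_injective.injOn]
    have h4 : (T.card : ℝ)⁻¹ * ∑ t ∈ T, φ (t⁻¹ • x) - c =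
        (T.card : ℝ)⁻¹ * ∑ t ∈ T, (φ (t⁻¹ • x) - c) := by
      rw [Finset.sum_sub_distrib, mul_sub]
      simp [hT0.ne']
    rw [h4, abs_mul, abs_of_pos (inv_pos.2 hT0)]
    simp only [h3]
    gcongr
    exact Finset.abs_sum_le_sum_abs _ _

end Ergodic

/-! ### A maximum principle for ergodic measures -/

section MaximumPrinciple

/-- Complements of finite unions of basic open sets form a countable π-system generating the Borel
sets. Closedness matters because `μ ↦ μ (C n)` must be upper semicontinuous. -/
lemma exists_seq_isClosed_separating (X : Type*) [TopologicalSpace X] [SecondCountableTopology X]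
    [MeasurableSpace X] [BorelSpace X] :
    ∃ C : ℕ → Set X, (∀ n, IsClosed (C n)) ∧ ∀ μ ν : ProbabilityMeasure X,
      (∀ n, (μ : Measure X) (C n) = (ν : Measure X) (C n)) → μ = ν := by
  set B := TopologicalSpace.countableBasis X with hB
  have hbasis := TopologicalSpace.isBasis_countableBasis X
  set 𝒞 : Set (Set X) := (fun t : Set (Set X) => (⋃₀ t)ᶜ) '' {t | t.Finite ∧ t ⊆ B} with h𝒞
  have hcount : 𝒞.Countable :=
    (Set.countable_ofPred_finite_subset (TopologicalSpace.countable_countableBasis X)).image _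
  have hne : 𝒞.Nonempty := ⟨_, ∅, ⟨finite_empty, empty_subset _⟩, rfl⟩
  have hclosed : ∀ F ∈ 𝒞, IsClosed F := by
    rintro _ ⟨t, ⟨-, ht⟩, rfl⟩
    exact (isOpen_sUnion fun U hU => hbasis.isOpen (ht hU)).isClosed_compl
  have hpi : IsPiSystem 𝒞 := by
    rintro _ ⟨t, ht, rfl⟩ _ ⟨t', ht', rfl⟩ -
    refine ⟨t ∪ t', ⟨ht.1.union ht'.1, union_subset ht.2 ht'.2⟩, ?_⟩
    simp only [sUnion_union, compl_union]
  have hgen : ‹MeasurableSpace X› = MeasurableSpace.generateFrom 𝒞 := by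
    refine le_antisymm ?_ (MeasurableSpace.generateFrom_le fun F hF => (hclosed F hF).measurableSet)
    rw [BorelSpace.measurable_eq (α := X), hbasis.borel_eq_generateFrom]
    refine MeasurableSpace.generateFrom_le fun U hU => ?_
    rw [← compl_compl U]
    refine MeasurableSet.compl (MeasurableSpace.measurableSet_generateFrom ⟨{U}, ?_, by simp⟩)
    exact ⟨finite_singleton U, singleton_subset_iff.2 hU⟩
  obtain ⟨C, hC⟩ := hcount.exists_eq_range hne
  refine ⟨C, fun n => hclosed _ (hC ▸ mem_range_self n), fun μ ν h => ?_⟩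
  refine ProbabilityMeasure.toMeasure_injective (ext_of_generate_finite 𝒞 hgen hpi ?_ (by simp))
  intro F hF
  obtain ⟨n, rfl⟩ : F ∈ range C := hC ▸ hF
  exact h n

variable {G X : Type*} [Group G] [MetricSpace X] [CompactSpace X] [MeasurableSpace X]
  [BorelSpace X] [MulAction G X] [ContinuousConstSMul G X]

lemma isClosed_invariantMeasures : IsClosed (invariantMeasures G X) := by
  have : invariantMeasures G X = ⋂ (g : G) (f : C(X, ℝ)), {μ : ProbabilityMeasure X |
      ∫ x, f (g • x) ∂(μ : Measure X) = ∫ x, f x ∂(μ : Measure X)} := by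
    ext μ
    simp only [mem_iInter, mem_ofPred_eq]
    exact mem_invariantMeasures_iff
  rw [this]
  refine isClosed_iInter fun g => isClosed_iInter fun f => isClosed_eq ?_ ?_
  · exact ProbabilityMeasure.continuous_integral_continuousMap
      (f.comp ⟨fun x => g • x, continuous_const_smul g⟩)
  · exact ProbabilityMeasure.continuous_integral_continuousMap f

/-- The maximizers over `M` of the measures of `C 0`, then `C 1`, and so on. -/
def lexMaximizers (M : Set (ProbabilityMeasure X)) (C : ℕ → Set X) :
    ℕ → Set (ProbabilityMeasure X)
  | 0 => M
  | n + 1 => {μ ∈ lexMaximizers M C n | ∀ ν ∈ lexMaximizers M C n,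
      (ν : Measure X) (C n) ≤ (μ : Measure X) (C n)}

lemma lexMaximizers_nonempty_isCompact {M : Set (ProbabilityMeasure X)} (hM : IsCompact M)
    (hM0 : M.Nonempty) {C : ℕ → Set X} (hC : ∀ n, IsClosed (C n)) (n : ℕ) :
    (lexMaximizers M C n).Nonempty ∧ IsCompact (lexMaximizers M C n) := by
  induction n with
  | zero => exact ⟨hM0, hM⟩
  | succ n ih =>
    have husc := upperSemicontinuous_measure_of_isClosed (hC n)
    obtain ⟨μ, hμ, hmax⟩ := (husc.upperSemicontinuousOn (lexMaximizers M C n)).exists_isMaxOn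
      ih.1 ih.2
    have heq : lexMaximizers M C (n + 1) = lexMaximizers M C n ∩
        (fun ν : ProbabilityMeasure X => (ν : Measure X) (C n)) ⁻¹' Ici ((μ : Measure X) (C n)) := by
      ext ν
      exact ⟨fun h => ⟨h.1, h.2 μ hμ⟩, fun h => ⟨h.1, fun κ hκ => (hmax hκ).trans h.2⟩⟩
    refine ⟨⟨μ, hμ, fun ν hν => hmax hν⟩, ?_⟩
    rw [heq]
    exact ih.2.inter_right (husc.isClosed_preimage _)

/-- An upper semicontinuous affine functional of the form `μ ↦ μ F` attains its maximum over the
invariant measures at an ergodic measure. -/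
lemma exists_mem_ergodicMeasures_le {F : Set X} (hF : IsClosed F) {μ : ProbabilityMeasure X}
    (hμ : μ ∈ invariantMeasures G X) :
    ∃ ν ∈ ergodicMeasures G X, (μ : Measure X) F ≤ (ν : Measure X) F := by
  obtain ⟨D, hD, hsep⟩ := exists_seq_isClosed_separating X
  -- Maximizing on `F` first secures the inequality. Maximizing on the separating sets `D n`
  -- afterwards leaves a single measure, and it is extreme because every set of lexicographic
  -- maximizers is a face.
  let C : ℕ → Set X := fun n => Nat.casesOn n F D
  have hC : ∀ n, IsClosed (C n) := fun n => by cases n <;> simp [C, hF, hD]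
  set L := lexMaximizers (invariantMeasures G X) C with hL
  have hLc := lexMaximizers_nonempty_isCompact (isClosed_invariantMeasures (G := G)).isCompact
    ⟨μ, hμ⟩ hC
  obtain ⟨ν, hν⟩ := IsCompact.nonempty_iInter_of_sequence_nonempty_isCompact_isClosed L
    (fun n => sep_subset _ _) (fun n => (hLc n).1) (hLc 0).2 fun n => (hLc n).2.isClosed
  have hν : ∀ n, ν ∈ L n := mem_iInter.1 hν
  refine ⟨ν, mem_extremePoints.2 ⟨⟨ν, hν 0, rfl⟩, ?_⟩, (hν 1).2 μ hμ⟩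
  rintro _ ⟨κ₁, hκ₁, rfl⟩ _ ⟨κ₂, hκ₂, rfl⟩ ⟨a, b, ha, hb, hab, hν'⟩
  have hval : ∀ B : Set X,
      a * (κ₁ : Measure X) B + b * (κ₂ : Measure X) B = (ν : Measure X) B := fun B => by
    rw [← hν']; simp
  have hat : a ≠ ∞ := fun h => by simp [h] at hab
  have hbt : b ≠ ∞ := fun h => by simp [h] at hab
  -- The face property: a proper convex combination reaches a common upper bound only if both terms
  -- do.
  have key : ∀ {x y z : ℝ≥0∞}, z ≠ ∞ → a * x + b * y = z → x ≤ z → y ≤ z → x = z ∧ y = z := by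
    intro x y z hz h hx hy
    have hz' : z = a * z + b * z := by rw [← add_mul, hab, one_mul]
    constructor
    · refine hx.antisymm (not_lt.1 fun hlt => ?_)
      have : a * x + b * y < a * z + b * z :=
        ENNReal.add_lt_add_of_lt_of_le (ENNReal.mul_ne_top hbt (hy.trans_lt hz.lt_top).ne)
          ((ENNReal.mul_lt_mul_iff_right ha.ne' hat).2 hlt) (by gcongr)
      rw [h, ← hz'] at this
      exact this.false
    · refine hy.antisymm (not_lt.1 fun hlt => ?_)
      have : a * x + b * y < a * z + b * z :=
        ENNReal.add_lt_add_of_le_of_lt (ENNReal.mul_ne_top hat (hx.trans_lt hz.lt_top).ne)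
          (by gcongr) ((ENNReal.mul_lt_mul_iff_right hb.ne' hbt).2 hlt)
      rw [h, ← hz'] at this
      exact this.false
  have hmem : ∀ n, κ₁ ∈ L n ∧ κ₂ ∈ L n := by
    intro n
    induction n with
    | zero => exact ⟨hκ₁, hκ₂⟩
    | succ n ih =>
      have hmax := (hν (n + 1)).2
      obtain ⟨h1, h2⟩ := key (measure_ne_top _ _) (hval (C n)) (hmax κ₁ ih.1) (hmax κ₂ ih.2)
      exact ⟨⟨ih.1, fun κ hκ => h1 ▸ hmax κ hκ⟩, ⟨ih.2, fun κ hκ => h2 ▸ hmax κ hκ⟩⟩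
  have heq : ∀ n, (κ₁ : Measure X) (C n) = (ν : Measure X) (C n) ∧
      (κ₂ : Measure X) (C n) = (ν : Measure X) (C n) := fun n =>
    key (measure_ne_top _ _) (hval (C n)) ((hν (n + 1)).2 κ₁ (hmem n).1)
      ((hν (n + 1)).2 κ₂ (hmem n).2)
  rw [hsep κ₁ ν fun n => (heq (n + 1)).1, hsep κ₂ ν fun n => (heq (n + 1)).2]
  exact ⟨rfl, rfl⟩

end MaximumPrinciple

/-! ### Castles with uniformly small remainder -/

section Gluing

variable {G : Type u} {X : Type v} [Group G] [MetricSpace X] [CompactSpace X] [MeasurableSpace X]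
  [BorelSpace X] [MulAction G X] [ContinuousConstSMul G X]

/-- Pairs lying in no common member of `𝒱` form a compact set off the diagonal. Each is separated by
the integral of some continuous function, which can be rescaled to a gap of 2; finitely many
functions then suffice for a gap above 1. -/
lemma exists_finset_separating {E : Set (ProbabilityMeasure X)} (hE : IsCompact E)
    {𝒱 : Set (Set E)} (ho : ∀ W ∈ 𝒱, IsOpen W) (hc : ⋃₀ 𝒱 = univ) :
    ∃ Φ : Finset C(X, ℝ), ∀ y z : E, (∀ W ∈ 𝒱, y ∈ W → z ∉ W) →
      ∃ f ∈ Φ, 1 < |∫ x, f x ∂(y.1 : Measure X) - ∫ x, f x ∂(z.1 : Measure X)| := by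
  have : CompactSpace E := isCompact_iff_compactSpace.1 hE
  set D : Set (E × E) := (⋃ W ∈ 𝒱, W ×ˢ W)ᶜ with hD
  have hDc : IsCompact D :=
    (isOpen_biUnion fun W hW => (ho W hW).prod (ho W hW)).isClosed_compl.isCompact
  have hcont : ∀ f : C(X, ℝ), Continuous fun y : E => ∫ x, f x ∂(y.1 : Measure X) := fun f =>
    (ProbabilityMeasure.continuous_integral_continuousMap f).comp continuous_subtype_val
  let O : C(X, ℝ) → Set (E × E) := fun f => {q |
    1 < |∫ x, f x ∂(q.1.1 : Measure X) - ∫ x, f x ∂(q.2.1 : Measure X)|}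
  have hO : ∀ f, IsOpen (O f) := fun f => isOpen_lt continuous_const
    (((hcont f).comp continuous_fst).sub ((hcont f).comp continuous_snd)).abs
  have hDO : D ⊆ ⋃ f, O f := by
    rintro ⟨y, z⟩ hyz
    have hne : y.1 ≠ z.1 := by
      intro h
      obtain ⟨W, hW, hyW⟩ := mem_sUnion.1 (hc ▸ mem_univ y : y ∈ ⋃₀ 𝒱)
      exact hyz (mem_iUnion₂.2 ⟨W, hW, hyW, (Subtype.ext h : y = z) ▸ hyW⟩)
    obtain ⟨f, hf⟩ : ∃ f : C(X, ℝ),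
        ∫ x, f x ∂(y.1 : Measure X) ≠ ∫ x, f x ∂(z.1 : Measure X) := by
      by_contra hcon
      push Not at hcon
      exact hne (eq_of_forall_integral_eq hcon)
    set a := |∫ x, f x ∂(y.1 : Measure X) - ∫ x, f x ∂(z.1 : Measure X)| with ha
    have ha0 : 0 < a := abs_pos.2 (sub_ne_zero.2 hf)
    refine mem_iUnion.2 ⟨(2 / a) • f, ?_⟩
    simp only [O, mem_ofPred_eq, ContinuousMap.coe_smul, Pi.smul_apply, smul_eq_mul,
      integral_const_mul, ← mul_sub, abs_mul, abs_of_pos (div_pos two_pos ha0), ← ha]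
    rw [div_mul_cancel₀ _ ha0.ne']
    norm_num
  obtain ⟨Φ, hΦ⟩ := hDc.elim_finite_subcover O hO hDO
  refine ⟨Φ, fun y z hyz => ?_⟩
  have hmem : (y, z) ∈ D := by
    simp only [hD, mem_compl_iff, mem_iUnion, not_exists]
    exact fun W hW h => hyz W hW h.1 h.2
  obtain ⟨f, hf, h⟩ := mem_iUnion₂.1 (hΦ hmem)
  exact ⟨f, hf, h⟩

lemma IsCastle.comp_equiv {K : Finset G} {δ : ℝ} {ι κ : Type*} {S : ι → Finset G}
    {V : ι → Set X} (h : IsCastle K δ S V) (e : κ ≃ ι) : IsCastle K δ (S ∘ e) (V ∘ e) where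
  isTower i := h.isTower (e i)
  isOpen i := h.isOpen (e i)
  shape i := h.shape (e i)
  diam_lt i := h.diam_lt (e i)
  disjoint _ _ hij := h.disjoint _ _ (e.injective.ne hij)

/-- The points at which the functions `ψ f`, `f ∈ Φ`, are `ρ`-close to the means of the functions
`f` with respect to some measure in `W`. -/
def nearPoints {E : Set (ProbabilityMeasure X)} (Φ : Finset C(X, ℝ)) (ψ : C(X, ℝ) → C(X, ℝ))
    (W : Set E) (ρ : ℝ) : Set X :=
  {x | ∃ y ∈ W, ∀ f ∈ Φ, |ψ f x - ∫ z, f z ∂(y.1 : Measure X)| < ρ}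

lemma isOpen_nearPoints {E : Set (ProbabilityMeasure X)} (Φ : Finset C(X, ℝ))
    (ψ : C(X, ℝ) → C(X, ℝ)) (W : Set E) (ρ : ℝ) : IsOpen (nearPoints Φ ψ W ρ) := by
  have : nearPoints Φ ψ W ρ = ⋃ y ∈ W, ⋂ f ∈ Φ,
      {x | |ψ f x - ∫ z, f z ∂(y.1 : Measure X)| < ρ} := by
    ext x; simp [nearPoints]
  rw [this]
  exact isOpen_biUnion fun y _ => isOpen_biInter_finset fun f _ =>
    isOpen_lt ((ψ f).continuous.sub continuous_const).abs continuous_const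

lemma mem_nearPoints_of_forall_abs_sub_lt {E : Set (ProbabilityMeasure X)} {Φ : Finset C(X, ℝ)}
    {ψ : C(X, ℝ) → C(X, ℝ)} {W : Set E} {ρ τ : ℝ} {x x' : X} (hx : x ∈ nearPoints Φ ψ W ρ)
    (h : ∀ f ∈ Φ, |ψ f x' - ψ f x| < τ) : x' ∈ nearPoints Φ ψ W (ρ + τ) := by
  obtain ⟨y, hy, hyx⟩ := hx
  refine ⟨y, hy, fun f hf => ?_⟩
  have := abs_sub_le (ψ f x') (ψ f x) (∫ z, f z ∂(y.1 : Measure X))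
  linarith [hyx f hf, h f hf]

lemma closure_nearPoints_subset {E : Set (ProbabilityMeasure X)} (Φ : Finset C(X, ℝ))
    (ψ : C(X, ℝ) → C(X, ℝ)) (W : Set E) (ρ : ℝ) {τ : ℝ} (hτ : 0 < τ) :
    closure (nearPoints Φ ψ W ρ) ⊆ nearPoints Φ ψ W (ρ + τ) := by
  intro x hx
  have ho : {x' | ∀ f ∈ Φ, |ψ f x - ψ f x'| < τ} ∈ 𝓝 x := by
    refine (Filter.eventually_all_finset Φ).2 fun f _ => ?_
    refine (isOpen_lt (continuous_const.sub (ψ f).continuous).abs continuous_const).mem_nhds ?_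
    simpa using hτ
  obtain ⟨x', hx', hx'W⟩ := mem_closure_iff_nhds.1 hx _ ho
  exact mem_nearPoints_of_forall_abs_sub_lt hx'W hx'

/-- Castles good for different parts of the ergodic measures may overlap. They are separated by
cutting their bases down to the points where nearly invariant functions take values close to the
integrals for the given part: near invariance carries this along the levels, and for ergodic
measures in the part little is lost. -/
lemma exists_isCastle_forall_measureReal_compl_lt (hG : IsAmenableGroup G)
    (hfree : IsFreeAction G X) (hE : IsCompact (ergodicMeasures G X))
    (hzero : IsZeroDimensional (ergodicMeasures G X)) (K : Finset G) {δ ε : ℝ} (hδ : 0 < δ)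
    (hε : 0 < ε) :
    ∃ (N : ℕ) (S : Fin N → Finset G) (V : Fin N → Set X), IsCastle K δ S V ∧
      ∀ μ ∈ invariantMeasures G X, (μ : Measure X).real (⋃ i, levels (S i) (V i))ᶜ < ε := by
  classical
  have : CompactSpace (ergodicMeasures G X) := isCompact_iff_compactSpace.1 hE
  choose ι hι S V hcastle hR using fun y : ergodicMeasures G X =>
    exists_isCastle_measureReal_compl_lt hG hfree K hδ (half_pos hε) (ergodicMeasures_subset y.2)
  have hopen : ∀ y, IsOpen (⋃ i, levels (S y i) (V y i)) := fun y =>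
    isOpen_iUnion fun i => isOpen_biUnion fun s _ => ((hcastle y).isOpen i).smul s
  let U : ergodicMeasures G X → Set (ergodicMeasures G X) := fun y =>
    {z | (z.1 : Measure X) (⋃ i, levels (S y i) (V y i))ᶜ < ENNReal.ofReal (ε / 2)}
  have hUo : ∀ y, IsOpen (U y) := fun y =>
    ((upperSemicontinuous_measure_of_isClosed (hopen y).isClosed_compl).isOpen_preimage
      (ENNReal.ofReal (ε / 2))).preimage continuous_subtype_val
  have hUy : ∀ y, y ∈ U y := fun y =>
    (ENNReal.lt_ofReal_iff_toReal_lt (measure_ne_top _ _)).2 (hR y)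
  obtain ⟨J, hJ⟩ := isCompact_univ.elim_nhds_subcover U fun y _ => (hUo y).mem_nhds (hUy y)
  -- Zero-dimensionality enters here: disjoint parts are needed so that separating functions can
  -- distinguish them.
  obtain ⟨𝒱, h𝒱f, h𝒱o, h𝒱c, h𝒱U, h𝒱d⟩ := hzero (U '' J) (J.finite_toSet.image U)
    (by rintro _ ⟨y, -, rfl⟩; exact hUo y)
    (by rw [sUnion_image]; exact univ_subset_iff.1 hJ.2)
  have hc : ∀ W : 𝒱, ∃ y, W.1 ⊆ U y := fun W => by
    obtain ⟨_, ⟨y, -, rfl⟩, h⟩ := h𝒱U W.1 W.2; exact ⟨y, h⟩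
  choose c hc using hc
  obtain ⟨Φ, hΦ⟩ := exists_finset_separating hE h𝒱o h𝒱c
  have := h𝒱f.to_subtype
  let κ := Σ W : 𝒱, ι (c W)
  have : Fintype κ := Fintype.ofFinite κ
  set K' : Finset G := Finset.univ.biUnion fun k : κ => S (c k.1) k.2 with hK'
  have hSK' : ∀ k : κ, S (c k.1) k.2 ⊆ K' := fun k =>
    Finset.subset_biUnion_of_mem (fun k : κ => S (c k.1) k.2) (Finset.mem_univ k)
  -- Markov's inequality at level `1 / 16` loses at most `16 η` for each `f ∈ Φ`, altogether at most
  -- `ε / 2`.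
  set η : ℝ := min (1 / 16) (ε / (32 * (Φ.card + 1))) with hη
  have hη0 : 0 < η := lt_min (by norm_num) (by positivity)
  choose ψ hψK hψE using fun f : C(X, ℝ) => exists_nearly_invariant hG hE f K' hη0
  -- Radii: a good point of a level has radius `1 / 16`, hence its base point `1 / 8`; taking the
  -- closure gives `1 / 4`, moving by `K'` at most `1 / 2`, and sets of radius `1 / 2` are disjoint
  -- because the gap exceeds 1.
  let Z : 𝒱 → ℝ → Set X := fun W ρ => nearPoints Φ ψ W.1 ρ
  have hZd : ∀ W W' : 𝒱, W ≠ W' → Disjoint (Z W (1 / 2)) (Z W' (1 / 2)) := by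
    intro W W' hne
    rw [Set.disjoint_left]
    rintro x ⟨y, hy, hyx⟩ ⟨y', hy', hyx'⟩
    obtain ⟨f, hf, h⟩ := hΦ y y' fun W'' hW'' h1 h2 => by
      have e1 : W.1 = W'' := h𝒱d.elim_set W.2 hW'' y hy h1
      have e2 : W'.1 = W'' := h𝒱d.elim_set W'.2 hW'' y' hy' h2
      exact hne (Subtype.ext (e1.trans e2.symm))
    have h1 := hyx f hf
    rw [abs_sub_comm] at h1
    have := abs_sub_le (∫ z, f z ∂(y.1 : Measure X)) (ψ f x) (∫ z, f z ∂(y'.1 : Measure X))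
    linarith [hyx' f hf]
  have hZK : ∀ W : 𝒱, ∀ g ∈ K', g • closure (Z W (1 / 8)) ⊆ Z W (1 / 2) := by
    rintro W g hg _ ⟨x, hx, rfl⟩
    have h1 := closure_nearPoints_subset Φ ψ W.1 (1 / 8) (τ := 1 / 8) (by norm_num) hx
    have h2 := mem_nearPoints_of_forall_abs_sub_lt (x' := g • x) (τ := 1 / 4) h1 fun f _ =>
      (hψK f g hg x).trans_le ((min_le_left _ _).trans (by norm_num))
    norm_num at h2
    norm_num [Z]
    exact h2
  let S' : κ → Finset G := fun k => S (c k.1) k.2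
  let V' : κ → Set X := fun k => V (c k.1) k.2 ∩ Z k.1 (1 / 8)
  have hV'V : ∀ k, closure (V' k) ⊆ closure (V (c k.1) k.2) := fun k =>
    closure_mono inter_subset_left
  have hV'Z : ∀ k, levels (S' k) (closure (V' k)) ⊆ Z k.1 (1 / 2) := fun k =>
    iUnion₂_subset fun s hs => (smul_set_mono (closure_mono inter_subset_right)).trans
      (hZK k.1 s (hSK' k hs))
  have hC : IsCastle K δ S' V' :=
    { isTower := fun k => ((hcastle (c k.1)).isTower k.2).mono subset_rfl (hV'V k)
      isOpen := fun k => ((hcastle (c k.1)).isOpen k.2).inter (isOpen_nearPoints _ _ _ _)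
      shape := fun k => (hcastle (c k.1)).shape k.2
      diam_lt := fun k s hs => (Metric.diam_mono (smul_set_mono (hV'V k))
        Metric.isBounded_of_compactSpace).trans_lt ((hcastle (c k.1)).diam_lt k.2 s hs)
      disjoint := by
        rintro ⟨W, i⟩ ⟨W', i'⟩ hne
        by_cases hW : W = W'
        · subst hW
          exact ((hcastle (c W)).disjoint i i' fun h => hne (by rw [h])).mono
            (levels_mono subset_rfl (hV'V ⟨W, i⟩)) (levels_mono subset_rfl (hV'V ⟨W, i'⟩))
        · exact (hZd W W' hW).mono (hV'Z ⟨W, i⟩) (hV'Z ⟨W', i'⟩) }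
  have hrem : ∀ μ ∈ ergodicMeasures G X,
      (μ : Measure X).real (⋃ k, levels (S' k) (V' k))ᶜ < ε := by
    intro μ hμ
    obtain ⟨W, hW, hyW⟩ := mem_sUnion.1
      (h𝒱c ▸ mem_univ _ : (⟨μ, hμ⟩ : ergodicMeasures G X) ∈ ⋃₀ 𝒱)
    set y := c ⟨W, hW⟩ with hy
    have h1 : (μ : Measure X).real (⋃ i, levels (S y i) (V y i))ᶜ < ε / 2 :=
      (ENNReal.lt_ofReal_iff_toReal_lt (measure_ne_top _ _)).1 (hc ⟨W, hW⟩ hyW)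
    have hsub : (⋃ k, levels (S' k) (V' k))ᶜ ⊆ (⋃ i, levels (S y i) (V y i))ᶜ ∪
        ⋃ f ∈ Φ, {x | 1 / 16 ≤ |ψ f x - ∫ z, f z ∂(μ : Measure X)|} := by
      intro x hx
      by_contra hcon
      rw [mem_union, not_or, mem_compl_iff, not_not] at hcon
      obtain ⟨hxR, hψx⟩ := hcon
      simp only [mem_iUnion, not_exists, mem_ofPred_eq, not_le] at hψx
      obtain ⟨i, hi⟩ := mem_iUnion.1 hxR
      obtain ⟨s, hs, v, hv, rfl⟩ := mem_levels.1 hi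
      refine hx (mem_iUnion.2 ⟨⟨⟨W, hW⟩, i⟩, mem_levels.2 ⟨s, hs, v, ⟨hv, ?_⟩, rfl⟩⟩)
      have hsv : s • v ∈ nearPoints Φ ψ W (1 / 16) := ⟨⟨μ, hμ⟩, hyW, hψx⟩
      have := mem_nearPoints_of_forall_abs_sub_lt (x' := v) (τ := 1 / 16) hsv fun f _ => by
        rw [abs_sub_comm]
        exact (hψK f s (hSK' ⟨⟨W, hW⟩, i⟩ hs) v).trans_le (min_le_left _ _)
      norm_num at this
      norm_num [Z]
      exact this
    have h2 : ∀ f ∈ Φ, (μ : Measure X).real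
        {x | 1 / 16 ≤ |ψ f x - ∫ z, f z ∂(μ : Measure X)|} ≤ 16 * η := by
      intro f _
      have hmark := mul_meas_ge_le_integral_of_nonneg (μ := (μ : Measure X))
        (f := fun x => |ψ f x - ∫ z, f z ∂(μ : Measure X)|)
        (Eventually.of_forall fun x => abs_nonneg _)
        ((integrable_continuousMap _ _).sub (integrable_const _)).abs (1 / 16)
      have := hψE f μ hμ
      linarith
    have h3 := (measureReal_mono (μ := (μ : Measure X)) hsub).trans (measureReal_union_le _ _)
    have h4 : (μ : Measure X).real
        (⋃ f ∈ Φ, {x | 1 / 16 ≤ |ψ f x - ∫ z, f z ∂(μ : Measure X)|}) ≤ ε / 2 := by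
      refine (measureReal_biUnion_finset_le Φ _).trans ((Finset.sum_le_sum h2).trans ?_)
      rw [Finset.sum_const, nsmul_eq_mul]
      have : η * (32 * (Φ.card + 1)) ≤ ε :=
        (le_div_iff₀ (by positivity)).1 (min_le_right _ _)
      nlinarith
    linarith
  have hopen' : IsOpen (⋃ k, levels (S' k) (V' k)) :=
    isOpen_iUnion fun k => isOpen_biUnion fun s _ => (hC.isOpen k).smul s
  let e := (Fintype.equivFin κ).symm
  refine ⟨Fintype.card κ, S' ∘ e, V' ∘ e, hC.comp_equiv e, fun μ hμ => ?_⟩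
  have heq : ⋃ i, levels ((S' ∘ e) i) ((V' ∘ e) i) = ⋃ k, levels (S' k) (V' k) :=
    e.surjective.iUnion_comp fun k => levels (S' k) (V' k)
  rw [heq]
  obtain ⟨ν, hν, hle⟩ := exists_mem_ergodicMeasures_le hopen'.isClosed_compl hμ
  exact (ENNReal.toReal_mono (measure_ne_top _ _) hle).trans_lt (hrem ν hν)

end Gluing

/-! ### From `m`-comparison to almost finiteness -/

section Comparison

variable {G : Type u} {X : Type v} [Group G] [MetricSpace X] [CompactSpace X] [MeasurableSpace X]
  [BorelSpace X] [MulAction G X] [ContinuousConstSMul G X]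

/-- If every shape contains `m + 1` disjoint spare sets of equal size, a coloured subequivalence
into the levels of the first spare sets gives an uncoloured one into all spare levels. -/
lemma SubequivM.of_spare_levels {m N : ℕ} {F : Set X} {S : Fin N → Finset G} {V : Fin N → Set X}
    (ht : ∀ i, IsTower (S i) (V i)) (hV : ∀ i, IsOpen (V i))
    (hd : ∀ i j, i ≠ j → Disjoint (levels (S i) (V i)) (levels (S j) (V j)))
    {T : Fin N → Finset G} {S' : Fin N → Finset G} (hS' : ∀ i, S' i ⊆ S i)
    (φ : ∀ i, T i × Fin (m + 1) → S' i) (hφ : ∀ i, Function.Injective (φ i))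
    (hF : SubequivM G m F (⋃ i, levels (T i) (V i))) :
    SubequivM G 0 F (⋃ i, levels (S' i) (V i)) := by
  obtain ⟨L, U, g, c, hUo, hUc, hUO, hUd⟩ := hF
  let J := Σ i, (T i × Fin L)
  let W : J → Set X := fun j => U j.2.2 ∩ (g j.2.2)⁻¹ • ((j.2.1 : G) • V j.1)
  -- The colour of a piece selects its target level, so pieces can share a target only if they have
  -- the same colour and intermediate level.
  let a : J → G := fun j => (φ j.1 (j.2.1, c j.2.2) : G) * (j.2.1 : G)⁻¹ * g j.2.2
  have hW : ∀ j, a j • W j ⊆ (φ j.1 (j.2.1, c j.2.2) : G) • V j.1 := by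
    rintro ⟨i, s, l⟩
    refine (smul_set_mono inter_subset_right).trans ?_
    simp only [a, smul_smul, mul_assoc, mul_inv_cancel_left, inv_mul_cancel, mul_one]
    exact subset_rfl
  have hφS : ∀ i p, (φ i p : G) ∈ S i := fun i p => hS' i (φ i p).2
  refine subequivM_of_finite W a (fun _ => 0) ?_ ?_ ?_ ?_
  · rintro ⟨i, s, l⟩
    exact (hUo l).inter (((hV i).smul _).smul _)
  · intro x hx
    obtain ⟨l, hl⟩ := mem_iUnion.1 (hUc hx)
    obtain ⟨i, hi⟩ := mem_iUnion.1 (hUO l (smul_mem_smul_set hl))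
    obtain ⟨s, hs, v, hv, hsv⟩ := mem_levels.1 hi
    refine mem_iUnion.2 ⟨⟨i, ⟨s, hs⟩, l⟩, hl, ?_⟩
    rw [mem_inv_smul_set_iff, ← hsv]
    exact smul_mem_smul_set hv
  · rintro ⟨i, p⟩
    exact (hW ⟨i, p⟩).trans ((smul_subset_levels (φ i _).2).trans
      (subset_iUnion (fun i => levels (S' i) (V i)) i))
  · rintro ⟨i, s, l⟩ ⟨i', s', l'⟩ hne -
    by_cases hii : i = i'
    · subst hii
      by_cases hp : (s, c l) = (s', c l')
      · obtain ⟨rfl, hcl⟩ := Prod.mk.inj hp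
        have hll : l ≠ l' := fun h => hne (by rw [h])
        simp only [a, W, hcl]
        rw [mul_smul _ (g l), mul_smul _ (g l'), disjoint_smul_set]
        exact (hUd l l' hll hcl).mono (smul_set_mono inter_subset_left)
          (smul_set_mono inter_subset_left)
      · exact (ht i _ (hφS i (s, c l)) _ (hφS i (s', c l')) fun h =>
          hp (hφ i (Subtype.ext h))).mono (hW ⟨i, s, l⟩) (hW ⟨i, s', l'⟩)
    · exact (hd i i' hii).mono ((hW ⟨i, s, l⟩).trans (smul_subset_levels (hφS i _)))
        ((hW ⟨i', s', l'⟩).trans (smul_subset_levels (hφS i' _)))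

lemma Finset.exists_subset_prod_fin_injective {α : Type*} (S : Finset α) {q k : ℕ}
    (h : q * k ≤ S.card) :
    ∃ (S' T : Finset α) (φ : T × Fin k → S'), S' ⊆ S ∧ S'.card = q * k ∧ T ⊆ S ∧
      (0 < k → T.card = q) ∧ Function.Injective φ := by
  obtain ⟨S', hS', hcard⟩ := Finset.exists_subset_card_eq h
  -- For `k = 0` the hypothesis does not bound `q`, so `S` need not contain `q` elements.
  rcases Nat.eq_zero_or_pos k with rfl | hk
  · exact ⟨S', ∅, fun p => absurd p.1.2 (Finset.notMem_empty _), hS', hcard,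
      Finset.empty_subset _, fun h => absurd h (lt_irrefl 0),
      fun p => absurd p.1.2 (Finset.notMem_empty _)⟩
  obtain ⟨T, hT, hTc⟩ := Finset.exists_subset_card_eq ((Nat.le_mul_of_pos_right q hk).trans h)
  obtain ⟨φ⟩ : Nonempty ((T × Fin k) ↪ S') := Function.Embedding.nonempty_of_card_le
    (by simp [hcard, hTc])
  exact ⟨S', T, φ, hS', hcard, hT, fun _ => hTc, φ.injective⟩

/-- A fixed small proportion of the levels of each tower still outweighs a sufficiently small
remainder for every invariant measure, so `m`-comparison applies to the two. -/
lemma HasMComparison.isAlmostFinite [Infinite G] {m : ℕ} (hcomp : HasMComparison G X m)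
    (hcastle : ∀ (K : Finset G) (δ ε : ℝ), 0 < δ → 0 < ε →
      ∃ (N : ℕ) (S : Fin N → Finset G) (V : Fin N → Set X), IsCastle K δ S V ∧
        ∀ μ ∈ invariantMeasures G X, (μ : Measure X).real (⋃ i, levels (S i) (V i))ᶜ < ε) :
    IsAlmostFinite G X := by
  classical
  intro n hn K δ hδ
  -- With `q = ⌊|S| / d⌋`, the `q (m + 1)` spare levels are at most `|S| / n`. As `|S| ≥ d`, forced
  -- by `K₀`, one has `q ≥ |S| / (2 d)`. Thus the levels over `T` carry at least `1 / (2 d)` of the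
  -- castle, which exceeds the remainder once that is below `1 / (2 d + 1)`.
  set d := n * (m + 1) with hd
  have hd0 : 0 < d := by positivity
  obtain ⟨K₀, hK₀⟩ := Infinite.exists_subset_card_eq G d
  obtain ⟨N, S, V, hC, hrem⟩ := hcastle (K ∪ K₀) (min δ (1 / 2)) (1 / (2 * d + 1))
    (lt_min hδ (by norm_num)) (by positivity)
  have hScard : ∀ i, d ≤ (S i).card := fun i => by
    rw [← hK₀]
    exact (Finset.card_le_card Finset.subset_union_right).trans
      ((hC.shape i).card_le ((min_le_right _ _).trans_lt (by norm_num)))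
  set q : Fin N → ℕ := fun i => (S i).card / d with hq
  have hq1 : ∀ i, q i * d ≤ (S i).card := fun i => Nat.div_mul_le_self _ _
  have hq2 : ∀ i, (S i).card ≤ 2 * d * q i := fun i => by
    have h1 := Nat.div_add_mod (S i).card d
    have h2 := Nat.mod_lt (S i).card hd0
    have h3 : 1 ≤ q i := (Nat.one_le_div_iff hd0).2 (hScard i)
    have h4 : d * q i + (S i).card % d = (S i).card := h1
    nlinarith
  choose S' T φ hS'S hS'c hTS hTc hφ using fun i =>
    Finset.exists_subset_prod_fin_injective (S i) (q := q i) (k := m + 1)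
      ((Nat.mul_le_mul_left _ (Nat.le_mul_of_pos_left _ hn)).trans (hq1 i))
  have hTower : ∀ i, IsTower (S i) (V i) := fun i => (hC.isTower i).mono subset_rfl subset_closure
  have hDisj : ∀ i j, i ≠ j → Disjoint (levels (S i) (V i)) (levels (S j) (V j)) :=
    fun i j hij => (hC.disjoint i j hij).mono (levels_mono subset_rfl subset_closure)
      (levels_mono subset_rfl subset_closure)
  have hlev : ∀ (S : Finset G) i, IsOpen (levels S (V i)) := fun S i =>
    isOpen_biUnion fun s _ => (hC.isOpen i).smul s
  refine ⟨N, S, V, hC.isTower, hC.isOpen,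
    fun i => (hC.shape i).mono Finset.subset_union_left (min_le_left _ _),
    fun i s hs => (hC.diam_lt i s hs).trans_le (min_le_left _ _),
    ⟨fun _ => 0, fun i j hij _ => hC.disjoint i j hij⟩, S', hS'S, fun i => ?_, ?_⟩
  · rw [le_div_iff₀ (by exact_mod_cast hn)]
    have : (S' i).card * n ≤ (S i).card := by
      refine le_trans (le_of_eq ?_) (hq1 i)
      rw [hS'c, hd]; ring
    exact_mod_cast this
  · refine SubequivM.of_spare_levels hTower hC.isOpen hDisj hS'S φ hφ ?_
    refine hcomp _ _ (isOpen_iUnion fun i => hlev _ i).isClosed_compl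
      (isOpen_iUnion fun i => hlev _ i) fun μ hμ => ?_
    have hμ' : SMulInvariantMeasure G X (μ : Measure X) := hμ
    have h1 : (μ : Measure X).real (⋃ i, levels (S i) (V i)) ≤
        2 * d * (μ : Measure X).real (⋃ i, levels (T i) (V i)) := by
      have hT : (μ : Measure X).real (⋃ i, levels (T i) (V i)) =
          ∑ i, (q i : ℝ) * (μ : Measure X).real (V i) := by
        rw [measureReal_iUnion_fintype (fun i j hij => (hDisj i j hij).mono
          (levels_mono (hTS i) subset_rfl) (levels_mono (hTS j) subset_rfl))
          fun i => (hlev _ i).measurableSet]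
        refine Finset.sum_congr rfl fun i _ => ?_
        have := measureReal_levels_inter (μ : Measure X)
          ((hTower i).mono (hTS i) subset_rfl) (hC.isOpen i).measurableSet MeasurableSet.univ
        simpa [hTc] using this
      refine (measureReal_iUnion_fintype_le _).trans ?_
      rw [hT, Finset.mul_sum]
      refine Finset.sum_le_sum fun i _ => (measureReal_levels_le _ _ _).trans ?_
      rw [← mul_assoc]
      refine mul_le_mul_of_nonneg_right ?_ measureReal_nonneg
      exact_mod_cast hq2 i
    have h2 := hrem μ hμ
    have h3 := probReal_compl_eq_one_sub (μ := (μ : Measure X))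
      (isOpen_iUnion fun i => hlev (S i) i).measurableSet
    refine (ENNReal.toReal_lt_toReal (measure_ne_top _ _) (measure_ne_top _ _)).1 ?_
    change (μ : Measure X).real _ < (μ : Measure X).real _
    by_contra hcon
    have hd' : (0 : ℝ) < 2 * d + 1 := by positivity
    rw [lt_div_iff₀ hd'] at h2
    have h4 : 2 * (d : ℝ) * (μ : Measure X).real (⋃ i, levels (T i) (V i)) ≤
        2 * d * (μ : Measure X).real (⋃ i, levels (S i) (V i))ᶜ :=
      mul_le_mul_of_nonneg_left (not_lt.1 hcon) (by positivity)
    linarith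

end Comparison

end

theorem corollary3p6 (G X : Type*) [Group G] [Countable G] [Infinite G]
    (hG : IsAmenableGroup G)
    [MetricSpace X] [CompactSpace X] [Infinite X] [MeasurableSpace X] [BorelSpace X]
    [MulAction G X] [ContinuousConstSMul G X] [MulAction.IsMinimal G X]
    (hfree : IsFreeAction G X)
    (hcompact : IsCompact (ergodicMeasures G X))
    (hzero : IsZeroDimensional (ergodicMeasures G X)) :
    List.TFAE [
      IsAlmostFinite G X,
      ∃ m : ℕ, IsMAlmostFinite G X m,
      HasComparison G X,
      ∃ m : ℕ, HasMComparison G X m] := by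
  have hcastle := fun (K : Finset G) (δ ε : ℝ) (hδ : 0 < δ) (hε : 0 < ε) =>
    exists_isCastle_forall_measureReal_compl_lt (X := X) hG hfree hcompact hzero K hδ hε
  tfae_have 1 → 2 := fun h => ⟨0, h⟩
  tfae_have 1 → 3 := fun h => IsMAlmostFinite.hasMComparison h
  tfae_have 2 → 4 := fun ⟨m, h⟩ => ⟨m, h.hasMComparison⟩
  tfae_have 3 → 4 := fun h => ⟨0, h⟩
  tfae_have 4 → 1 := fun ⟨_, h⟩ => h.isAlmostFinite hcastle
  tfae_finish
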